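/- Let $h,g:\mathbb R^n\to\mathbb R$ be differentiable, with $L_h$- and $L_g$-Lipschitz gradients (Euclidean norm), $0<L_h\le L_g$. Let $f=h+g$ be convex ($\mu=0$) or $\mu$-strongly convex ($\mu>0$), with minimizer $x^\ast$. Let $\|x^0-x^\ast\|_2\le R$ and $\varepsilon>0$. The oracles return $\nabla h(x)$ and $\nabla g(x)$ at a queried point $x$, and every query counts as one call. Consider the following three-loop method with parameter $L=L_h$. * *Outer loop* $\mathrm{MS}(x^0,L,N)$ (Monteiro–Svaiter). Put $A_0=0$, $y^0=z^0=x^0$. For $k=0,\dots,N-1$ put $a_{k+1}=\frac12\big(\frac1L+\sqrt{\frac1{L^2}+\frac{4A_k}{L}}\big)$, $A_{k+1}=A_k+a_{k+1}$, $x^{k+1}=\frac{A_k}{A_{k+1}}y^k+\frac{a_{k+1}}{A_{k+1}}z^k$; let $y^{k+1}$ be the output of the middle loop started at $x^{k+1}$; put $z^{k+1}=z^k-a_{k+1}\nabla f(y^{k+1})$. The output is $y^N$. If $\mu=0$, take $N=\lceil\sqrt{2LR^2/\varepsilon}\,\rceil$. If $\mu>0$, run MS $T=\max\{1,\lceil\log_2(\mu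 R^2/\varepsilon)\rceil\}$ times in succession with $N=\lceil\sqrt{8L/\mu}\,\rceil$, each run starting at the output of the previous one. * *Middle loop*, started at $\zeta^0$. For $k=1,2,\dots$ compute $\zeta^k$ by applying the inner method, started at $\zeta^{k-1}$, to $\varphi_k(\zeta)=\langle\nabla h(\zeta^{k-1}),\zeta-\zeta^{k-1}\rangle+g(\zeta)+\frac L2\|\zeta-\zeta^0\|_2^2+\frac{L_h}2\|\zeta-\zeta^{k-1}\|_2^2$. Stop and return $\zeta^k$ as soon as $\|\nabla F(\zeta^k)\|_2\le\frac L2\|\zeta^k-\zeta^0\|_2$, where $F(\zeta)=f(\zeta)+\frac L2\|\zeta-\zeta^0\|_2^2$. * *Inner method*: $\big\lceil c\sqrt{L_g/L_h}\,(1+\ln(L_g/L_h))\big\rceil$ steps of either (i) Nesterov's accelerated gradient method with constant step, applied to the whole objective $\varphi_k$ with smoothness constant $L_g+L+L_h$ and strong convexity constant $L$; or (ii) Nesterov's accelerated gradient method for composite optimization (estimating-sequence form, fixed step parameter $L_g$), with smooth part $g$, which is assumed convex in this case, and the remaining terms of $\varphi_k$ as the composite part. There are absolute constants $c,C>0$ and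 $K\in\mathbb N$ such that, for both inner methods and in every dimension $n$, the following holds. a) If $\mu=0$ and $\varepsilon\le L_hR^2$, every middle loop stops after at most $K$ iterations, the method outputs $\hat x$ with $f(\hat x)-f(x^\ast)\le\varepsilon$, and it makes at most $$C\sqrt{\frac{L_hR^2}{\varepsilon}}\ \text{ calls for } h,\qquad C\sqrt{\frac{L_gR^2}{\varepsilon}}\Big(1+\ln\frac{L_g}{L_h}\Big)\ \text{ calls for } g .$$ b) If $0<\mu\le L_h$, the same holds for the restarted method, with at most $$C\sqrt{\frac{L_h}{\mu}}\Big(1+\ln^+\frac{\mu R^2}{\varepsilon}\Big)\ \text{ calls for } h,\qquad C\sqrt{\frac{L_g}{\mu}}\Big(1+\ln^+\frac{\mu R^2}{\varepsilon}\Big)\Big(1+\ln\frac{L_g}{L_h}\Big)\ \text{ calls for } g,$$ where $\ln^+t=\max\{0,\ln t\}$ and $\ln^+0=0$. These are the bounds $\tilde O(\sqrt{L_h/\mu})$ and $\tilde O(\sqrt{L_g/\mu})$ with the logarithms written out. -/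

import Mathlib

/-- An oracle program over the space `E` with result type `α`.  It may ask for the gradient of `h`
at a point (`callH`), ask for the gradient of `g` at a point (`callG`), return a value (`ret`), or
give up without a result (`abort`).  The functions `h` and `g` are accessible only through these
calls. -/
inductive OracleProg (E : Type) (α : Type) : Type
  | ret (a : α) : OracleProg E α
  | abort : OracleProg E α
  | callH (x : E) (k : E → OracleProg E α) : OracleProg E α
  | callG (x : E) (k : E → OracleProg E α) : OracleProg E α

/-- The outcome of a run: the returned value and the numbers of calls to the two oracles. -/
structure RunResult (α : Type) where
  output : α
  hCalls : ℕ
  gCalls : ℕ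

namespace OracleProg

variable {E α β : Type}

/-- Sequential composition of oracle programs. -/
def andThen : OracleProg E α → (α → OracleProg E β) → OracleProg E β
  | ret a, f => f a
  | abort, _ => abort
  | callH x k, f => callH x fun v => andThen (k v) f
  | callG x k, f => callG x fun v => andThen (k v) f

instance : Monad (OracleProg E) where
  pure := ret
  bind := andThen

/-- One call of the oracle for `h` at `x`. -/
def gradH (x : E) : OracleProg E E := callH x ret

/-- One call of the oracle for `g` at `x`. -/
def gradG (x : E) : OracleProg E E := callG x ret

/-- Run a program when the oracles answer with `oh` and `og`, counting the calls.
The value is `none` if the program gives up. -/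
def run (oh og : E → E) : OracleProg E α → Option (RunResult α)
  | ret a => some ⟨a, 0, 0⟩
  | abort => none
  | callH x k => (run oh og (k (oh x))).map fun r => ⟨r.output, r.hCalls + 1, r.gCalls⟩
  | callG x k => (run oh og (k (og x))).map fun r => ⟨r.output, r.hCalls, r.gCalls + 1⟩

end OracleProg

open OracleProg

/-- `f` is `L`-smooth: differentiable with `L`-Lipschitz gradient (Euclidean norm). -/
def IsLSmooth {E : Type} [NormedAddCommGroup E] [InnerProductSpace ℝ E] [CompleteSpace E]
    (L : ℝ) (f : E → ℝ) : Prop :=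
  Differentiable ℝ f ∧ ∀ x y, ‖gradient f x - gradient f y‖ ≤ L * ‖x - y‖

section Methods

variable {E : Type} [NormedAddCommGroup E] [InnerProductSpace ℝ E]

/-- `N` steps of Nesterov's accelerated gradient method (constant step scheme for an `M`-smooth,
`σ`-strongly convex objective), applied to the whole objective
`φ(v) = ⟨b, v⟩ + α / 2 * ‖v‖ ^ 2 + g(v)`.  The arguments `x`, `y` are the current iterate and the
current extrapolated point. -/
noncomputable def agmWhole (b : E) (α M σ : ℝ) : ℕ → E → E → OracleProg E E
  | 0, x, _ => pure x
  | N + 1, x, y => do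
    let d ← gradG y
    let x' := y - (1 / M) • (d + b + α • y)
    let y' := x' + ((√M - √σ) / (√M + √σ)) • (x' - x)
    agmWhole b α M σ N x' y'

/-- `N` steps of Nesterov's accelerated gradient method for composite optimization, applied to
`φ(v) = g(v) + Ψ(v)` with `M`-smooth part `g` and composite term
`Ψ(v) = ⟨b, v⟩ + α / 2 * ‖v‖ ^ 2`, with constant step parameter `M`.  The estimating function is
`ψ_k(v) = ‖v - v₀‖ ^ 2 / 2 + ∑ i ≤ k, a_i * (g(x_i) + ⟨∇ g(x_i), v - x_i⟩ + Ψ(v))`.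
The arguments are `A = ∑ a_i`, `s = ∑ a_i (∇ g(x_i) + b)` and the current iterate `x`; then
* `v = (v₀ - s) / (1 + α A)` is the minimizer of `ψ_k`,
* `a > 0` solves `a ^ 2 / (A + a) = 2 (1 + α A) / M`,
* `x'` minimizes `⟨∇ g(y), · - y⟩ + M / 2 * ‖· - y‖ ^ 2 + Ψ(·)`. -/
noncomputable def agmComposite (b : E) (α M : ℝ) (v₀ : E) : ℕ → ℝ → E → E → OracleProg E E
  | 0, _, _, x => pure x
  | N + 1, A, s, x => do
    let v := (1 / (1 + α * A)) • (v₀ - s)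
    let q := (1 + α * A) / M
    let a := q + √(q ^ 2 + 2 * q * A)
    let y := (A / (A + a)) • x + (a / (A + a)) • v
    let d ← gradG y
    let x' := (1 / (M + α)) • (M • y - d - b)
    let d' ← gradG x'
    agmComposite b α M v₀ N (A + a) (s + a • (d' + b)) x'

/-- The two ways to use the accelerated gradient method in the innermost loop. -/
inductive InnerMethod
  | whole
  | composite

/-- The inner method: `N` steps, started at `v₀`, of the chosen accelerated gradient method on
`φ(v) = ⟨b, v⟩ + α / 2 * ‖v‖ ^ 2 + g(v)`, where `g` is `Lg`-smooth.  On the whole objective the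
method uses the smoothness constant `Lg + α` and the strong convexity constant `σ`. -/
noncomputable def innerAGM (m : InnerMethod) (Lg : ℝ) (b : E) (α σ : ℝ) (N : ℕ) (v₀ : E) :
    OracleProg E E :=
  match m with
  | .whole => agmWhole b α (Lg + α) σ N v₀ v₀
  | .composite => agmComposite b α Lg v₀ N 0 0 v₀

/-- The gradient method for composite optimization, minimizing
`F(ζ) = h(ζ) + g(ζ) + L / 2 * ‖ζ - ζ₀‖ ^ 2`.  From the current point `ζ` it applies `N` steps of
the inner method, started at `ζ`, to
`φ(v) = ⟨∇ h(ζ), v - ζ⟩ + g(v) + L / 2 * ‖v - ζ₀‖ ^ 2 + Lh / 2 * ‖v - ζ‖ ^ 2`,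
and repeats this until `‖∇ F(ζ')‖ ≤ L / 2 * ‖ζ' - ζ₀‖` holds at the new point `ζ'`.
Up to a constant, `φ(v) = ⟨b, v⟩ + α / 2 * ‖v‖ ^ 2 + g(v)` with `α = L + Lh` and
`b = ∇ h(ζ) - L ζ₀ - Lh ζ`; it is `L`-strongly convex if `h + g` is convex and `h` is `Lh`-smooth.
The first natural number bounds the number of repetitions: the program gives up if the stopping
test has not succeeded by then. -/
noncomputable def gmco (m : InnerMethod) (Lh Lg L : ℝ) (N : ℕ) (ζ₀ : E) : ℕ → E → OracleProg E E
  | 0, _ => abort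
  | K + 1, ζ => do
    let dh ← gradH ζ
    let ζ' ← innerAGM m Lg (dh - L • ζ₀ - Lh • ζ) (L + Lh) L N ζ
    let dh' ← gradH ζ'
    let dg' ← gradG ζ'
    if ‖dh' + dg' + L • (ζ' - ζ₀)‖ ≤ L / 2 * ‖ζ' - ζ₀‖ then pure ζ'
    else gmco m Lh Lg L N ζ₀ K ζ'

/-- The main loop of the Monteiro–Svaiter method for `f = h + g`; the arguments after the number of
remaining iterations are the current `A`, `y`, `z`. -/
noncomputable def msLoop (m : InnerMethod) (Lh Lg L : ℝ) (N K : ℕ) :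
    ℕ → ℝ → E → E → OracleProg E E
  | 0, _, y, _ => pure y
  | k + 1, A, y, z => do
    let a := (1 / L + √(1 / L ^ 2 + 4 * A / L)) / 2
    let A' := A + a
    let x' := (A / A') • y + (a / A') • z
    let y' ← gmco m Lh Lg L N x' K x'
    let dh ← gradH y'
    let dg ← gradG y'
    msLoop m Lh Lg L N K k A' y' (z - a • (dh + dg))

/-- The Monteiro–Svaiter method with `k` iterations, started at `x₀`. -/
noncomputable def ms (m : InnerMethod) (Lh Lg L : ℝ) (N K k : ℕ) (x₀ : E) : OracleProg E E :=
  msLoop m Lh Lg L N K k 0 x₀ x₀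

/-- The restarted Monteiro–Svaiter method: `T` runs of `k` iterations each, every run started at
the output of the preceding one. -/
noncomputable def msRestart (m : InnerMethod) (Lh Lg L : ℝ) (N K k : ℕ) :
    ℕ → E → OracleProg E E
  | 0, η => pure η
  | T + 1, η => do
    let η' ← ms m Lh Lg L N K k η
    msRestart m Lh Lg L N K k T η'

end Methods

/-- The number of steps of the inner method, with a numerical factor `c`. -/
noncomputable def innerSteps (c Lh Lg : ℝ) : ℕ :=
  ⌈c * √(Lg / Lh) * (1 + Real.log (Lg / Lh))⌉₊

/-- The number of iterations of the Monteiro–Svaiter method without strong convexity. -/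
noncomputable def convexIters (L R ε : ℝ) : ℕ :=
  ⌈√(2 * L * R ^ 2 / ε)⌉₊

/-- The number of iterations between two restarts. -/
noncomputable def restartIters (L μ : ℝ) : ℕ :=
  ⌈√(8 * L / μ)⌉₊

/-- The number of runs of the restarted method (at least one). -/
noncomputable def restartCount (μ R ε : ℝ) : ℕ :=
  max 1 ⌈Real.logb 2 (μ * R ^ 2 / ε)⌉₊

/-! Write `L` for `L_h`. The middle loop minimizes `F = f + L/2 ‖· - ζ₀‖²` through models `φ` that
linearize `h` at the current `ζ` and add `L/2 ‖· - ζ‖²`. Smoothness of `h` gives `F v - F ζ ≤ φ v -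
φ ζ ≤ F v - F ζ + L ‖v - ζ‖²`, and convexity of `h + g` makes `φ` strongly convex with constant `L`
even if `g` is not convex. Hence a minimization step on `φ`, exact or slightly inexact, contracts
the gap of `F` by a factor independent of `Lg` (`SmoothSum.middleStep`).

The stopping test is relative, on the scale `D = ‖ζ₀ - zs‖` with `zs` the minimizer of `F`. One step
brings the gap below `2 L D²`, a bound free of `Lg`; 21 contractions bring it below `L D² / 200`,
and then the next iterate passes (`MiddleStep.test`). This gives an absolute `K`.

The inner method must return `r` with `‖∇φ r‖ ≤ L/16 ‖ζ - u‖`, where `u` minimizes `φ`. This amounts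
to reducing the gap of `φ` relative to `Lg ‖ζ - u‖²` by a factor of order `(L/Lg)²`. The rate `exp
(-N √(L/Lg) / 2)` (`runsTo_innerAGM`) achieves this with `N` of order `√(Lg/L) (1 + ln (Lg/L))`
(`innerSteps_exp_le`).

The test is all the outer loop needs: the potential `A (f y - f u) + ‖z - u‖² / 2` does not increase
(`monteiroSvaiter_potential_step`) and `A_k ≥ k² / (4L)`, so the gap after `k` iterations is at most
`2 L R² / k²`. Under strong convexity each run halves the bound on the squared distance. An outer
iteration costs boundedly many calls for `h` and `O(N)` calls for `g`; multiplying by `√(Lg/L)`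
turns `√L` into `√Lg` in the iteration counts. -/

/-! ### Quadratic bounds from smoothness and convexity -/

section QuadraticBounds

variable {E : Type} [NormedAddCommGroup E] [InnerProductSpace ℝ E]

/-- `f` lies above its linearizations, given by the gradient map `f'`, by at least
`m / 2 * ‖y - x‖ ^ 2`. -/
def QuadLower (m : ℝ) (f : E → ℝ) (f' : E → E) : Prop :=
  ∀ x y, f x + inner ℝ (f' x) (y - x) + m / 2 * ‖y - x‖ ^ 2 ≤ f y

/-- `f` lies above its linearizations, given by the gradient map `f'`, by at most
`M / 2 * ‖y - x‖ ^ 2`. -/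
def QuadUpper (M : ℝ) (f : E → ℝ) (f' : E → E) : Prop :=
  ∀ x y, f y ≤ f x + inner ℝ (f' x) (y - x) + M / 2 * ‖y - x‖ ^ 2

theorem hasDerivAt_comp_line [CompleteSpace E] {f : E → ℝ} (hf : Differentiable ℝ f) (x d : E)
    (t : ℝ) :
    HasDerivAt (fun s : ℝ => f (x + s • d)) (inner ℝ (gradient f (x + t • d)) d) t := by
  have h1 := (hf (x + t • d)).hasGradientAt.hasFDerivAt
  have h2 : HasDerivAt (fun s : ℝ => x + s • d) d t := by
    simpa using ((hasDerivAt_id t).smul_const d).const_add x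
  refine (h1.comp_hasDerivAt t h2).congr_deriv ?_
  simp

theorem IsLSmooth.quadUpper [CompleteSpace E] {M : ℝ} {f : E → ℝ} (hf : IsLSmooth M f) :
    QuadUpper M f (gradient f) := by
  intro x y
  set d := y - x with hd
  set q : ℝ → ℝ := fun t => f (x + t • d) - t * inner ℝ (gradient f x) d - M / 2 * t ^ 2 * ‖d‖ ^ 2
  have hq : ∀ t, HasDerivAt q (inner ℝ (gradient f (x + t • d)) d - inner ℝ (gradient f x) d
      - M * t * ‖d‖ ^ 2) t := by
    intro t
    have h1 := ((hasDerivAt_comp_line hf.1 x d t).fun_sub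
      ((hasDerivAt_id' t).mul_const (inner ℝ (gradient f x) d))).fun_sub
      ((((hasDerivAt_id' t).fun_pow 2).const_mul (M / 2)).mul_const (‖d‖ ^ 2))
    refine h1.congr_deriv ?_
    push_cast
    ring
  have hanti : AntitoneOn q (Set.Icc 0 1) := by
    apply antitoneOn_of_deriv_nonpos (convex_Icc 0 1)
      (fun t _ => (hq t).continuousAt.continuousWithinAt)
      (fun t _ => (hq t).differentiableAt.differentiableWithinAt)
    intro t ht
    rw [interior_Icc] at ht
    rw [(hq t).deriv, ← inner_sub_left]
    have h1 := real_inner_le_norm (gradient f (x + t • d) - gradient f x) d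
    have h2 := hf.2 (x + t • d) x
    rw [add_sub_cancel_left, norm_smul, Real.norm_of_nonneg ht.1.le] at h2
    have h3 := mul_le_mul_of_nonneg_right h2 (norm_nonneg d)
    linarith
  have h01 := hanti (Set.left_mem_Icc.2 zero_le_one) (Set.right_mem_Icc.2 zero_le_one) zero_le_one
  simp only [q, one_smul, zero_smul, hd, add_sub_cancel, add_zero] at h01
  linarith

theorem QuadUpper.neg {M : ℝ} {f : E → ℝ} {f' : E → E}
    (hf : QuadUpper M (fun x => -f x) (fun x => -f' x)) : QuadLower (-M) f f' := by
  intro x y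
  have := hf x y
  simp only [inner_neg_left] at this
  linarith

theorem gradient_fun_neg [CompleteSpace E] (f : E → ℝ) (x : E) :
    gradient (fun x => -f x) x = -gradient f x := by
  have : fderiv ℝ (fun x => -f x) x = -fderiv ℝ f x := fderiv_fun_neg
  simp [gradient, this]

theorem IsLSmooth.quadLower [CompleteSpace E] {M : ℝ} {f : E → ℝ} (hf : IsLSmooth M f) :
    QuadLower (-M) f (gradient f) := by
  apply QuadUpper.neg
  have h : IsLSmooth M (fun x => -f x) := by
    refine ⟨hf.1.neg, fun x y => ?_⟩
    rw [gradient_fun_neg, gradient_fun_neg, neg_sub_neg, norm_sub_rev]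
    exact hf.2 x y
  have h2 := h.quadUpper
  rwa [show gradient (fun x => -f x) = fun x => -gradient f x from
    funext (gradient_fun_neg f)] at h2

theorem gradient_fun_add [CompleteSpace E] {f g : E → ℝ} (hf : Differentiable ℝ f)
    (hg : Differentiable ℝ g) (x : E) :
    gradient (fun x => f x + g x) x = gradient f x + gradient g x := by
  simp [gradient, fderiv_fun_add (hf x) (hg x)]

theorem StrongConvexOn.quadLower [CompleteSpace E] {m : ℝ} {f : E → ℝ}
    (hf : StrongConvexOn Set.univ m f) (hd : Differentiable ℝ f) :
    QuadLower m f (gradient f) := by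
  intro x y
  have h1 := hasDerivAt_comp_line hd x (y - x) 0
  rw [zero_smul, add_zero] at h1
  have h2 := h1.tendsto_slope_zero_right
  -- Strong convexity along the segment bounds the difference quotient of `f` by this expression;
  -- letting `t` tend to `0` from the right gives the gradient inequality.
  have h3 : Filter.Tendsto (fun t : ℝ => f y - f x - (1 - t) * (m / 2 * ‖y - x‖ ^ 2))
      (nhdsWithin 0 (Set.Ioi 0)) (nhds (f y - f x - (1 - 0) * (m / 2 * ‖y - x‖ ^ 2))) := by
    refine Filter.Tendsto.mono_left ?_ nhdsWithin_le_nhds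
    exact (Continuous.tendsto (by fun_prop) 0)
  have h4 := le_of_tendsto_of_tendsto h2 h3 (by
    filter_upwards [Ioo_mem_nhdsGT (zero_lt_one (α := ℝ))] with t ht
    have h5 := hf.2 (Set.mem_univ x) (Set.mem_univ y) (sub_nonneg.2 ht.2.le) ht.1.le (by ring)
    have h6 : (1 - t) • x + t • y = x + t • (y - x) := by module
    rw [h6, norm_sub_rev] at h5
    simp only [zero_add, zero_smul, add_zero, smul_eq_mul] at h5 ⊢
    rw [inv_mul_le_iff₀ ht.1]
    linarith)
  linarith

theorem QuadUpper.add {M N : ℝ} {f g : E → ℝ} {f' g' : E → E} (hf : QuadUpper M f f')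
    (hg : QuadUpper N g g') :
    QuadUpper (M + N) (fun x => f x + g x) (fun x => f' x + g' x) := by
  intro x y
  have h1 := hf x y
  have h2 := hg x y
  simp only [inner_add_left]
  linarith

theorem QuadLower.add {m n : ℝ} {f g : E → ℝ} {f' g' : E → E} (hf : QuadLower m f f')
    (hg : QuadLower n g g') :
    QuadLower (m + n) (fun x => f x + g x) (fun x => f' x + g' x) := by
  intro x y
  have h1 := hf x y
  have h2 := hg x y
  simp only [inner_add_left]
  linarith

theorem linear_add_sq_eq (b x y : E) (α : ℝ) :
    inner ℝ b y + α / 2 * ‖y‖ ^ 2 =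
      inner ℝ b x + α / 2 * ‖x‖ ^ 2 + inner ℝ (b + α • x) (y - x) + α / 2 * ‖y - x‖ ^ 2 := by
  have h := norm_add_sq_real x (y - x)
  rw [add_sub_cancel] at h
  rw [h, inner_add_left, inner_smul_left, inner_sub_right b]
  simp
  ring

/-- A gradient step of length `1 / M` from `x` cannot go below the minimum. This converts accuracy
in function values into accuracy of the gradient, the quantity that the stopping test sees. -/
theorem QuadUpper.norm_sq_le {M : ℝ} (hM : 0 < M) {f : E → ℝ} {f' : E → E}
    (hf : QuadUpper M f f') {u : E} (hu : ∀ v, f u ≤ f v) (x : E) :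
    ‖f' x‖ ^ 2 ≤ 2 * M * (f x - f u) := by
  have h1 := (hu _).trans (hf x (x - (1 / M) • f' x))
  rw [sub_sub_cancel_left, inner_neg_right, inner_smul_right, real_inner_self_eq_norm_sq, norm_neg,
    norm_smul, Real.norm_of_nonneg (by positivity), mul_pow] at h1
  have h2 : M / 2 * ((1 / M) ^ 2 * ‖f' x‖ ^ 2) = ‖f' x‖ ^ 2 / (2 * M) := by field_simp
  have h3 : 1 / M * ‖f' x‖ ^ 2 = 2 * (‖f' x‖ ^ 2 / (2 * M)) := by field_simp
  have h4 : ‖f' x‖ ^ 2 / (2 * M) ≤ f x - f u := by linarith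
  rw [div_le_iff₀ (by positivity)] at h4
  linarith

theorem QuadUpper.gradient_eq_zero {M : ℝ} (hM : 0 < M) {f : E → ℝ} {f' : E → E}
    (hf : QuadUpper M f f') {u : E} (hu : ∀ v, f u ≤ f v) : f' u = 0 := by
  have := hf.norm_sq_le hM hu u
  rw [sub_self, mul_zero] at this
  exact norm_eq_zero.1 (pow_eq_zero_iff two_ne_zero |>.1 (le_antisymm this (sq_nonneg _)))

theorem QuadLower.le_of_gradient_eq_zero {m : ℝ} {f : E → ℝ} {f' : E → E}
    (hf : QuadLower m f f') {u : E} (hu : f' u = 0) (x : E) :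
    f u + m / 2 * ‖x - u‖ ^ 2 ≤ f x := by
  simpa [hu] using hf u x

theorem QuadLower.sub_le_norm_sq {m : ℝ} (hm : 0 < m) {f : E → ℝ} {f' : E → E}
    (hf : QuadLower m f f') (x y : E) : f x - f y ≤ ‖f' x‖ ^ 2 / (2 * m) := by
  have h1 := hf x y
  have h2 := neg_le_of_abs_le (abs_real_inner_le_norm (f' x) (y - x))
  rw [le_div_iff₀ (by positivity)]
  nlinarith [sq_nonneg (‖f' x‖ - m * ‖y - x‖)]

/-- Cocoercivity of the gradient of a smooth convex function. -/
theorem inner_sub_gradient_ge {M : ℝ} (hM : 0 < M) {g : E → ℝ} {g' : E → E}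
    (hl : QuadLower 0 g g') (hu : QuadUpper M g g') (x y : E) :
    ‖g' y - g' x‖ ^ 2 ≤ M * inner ℝ (g' y - g' x) (y - x) := by
  -- The lower bound from `x` and the upper bound from `y` are compared at `y - (1 / M) • w`; adding
  -- the result to its copy with `x` and `y` exchanged gives cocoercivity.
  have key : ∀ x y, g x + inner ℝ (g' x) (y - x) + ‖g' y - g' x‖ ^ 2 / (2 * M) ≤ g y := by
    intro x y
    set w := g' y - g' x with hw
    have h1 := hl x (y - (1 / M) • w)
    have h2 := hu y (y - (1 / M) • w)
    rw [sub_sub_cancel_left, inner_neg_right, inner_smul_right, norm_neg,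
      norm_smul, Real.norm_of_nonneg (by positivity), mul_pow] at h2
    rw [sub_right_comm, inner_sub_right, inner_smul_right] at h1
    have h3 : 1 / M * inner ℝ (g' y) w - 1 / M * inner ℝ (g' x) w = 1 / M * ‖w‖ ^ 2 := by
      rw [← mul_sub, ← inner_sub_left, real_inner_self_eq_norm_sq]
    have h4 : M / 2 * ((1 / M) ^ 2 * ‖w‖ ^ 2) = ‖w‖ ^ 2 / (2 * M) := by field_simp
    have h5 : 1 / M * ‖w‖ ^ 2 = 2 * (‖w‖ ^ 2 / (2 * M)) := by field_simp
    linarith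
  have h1 := key x y
  have h2 := key y x
  rw [norm_sub_rev, ← neg_sub y x, inner_neg_right] at h2
  rw [inner_sub_left]
  have h3 : ‖g' y - g' x‖ ^ 2 = M * (2 * (‖g' y - g' x‖ ^ 2 / (2 * M))) := by field_simp
  rw [h3]
  exact mul_le_mul_of_nonneg_left (by linarith) hM.le

/-- The quadratic lower bound at `0` makes `f` coercive, and closed balls are compact in finite
dimension. -/
theorem QuadLower.exists_forall_le [FiniteDimensional ℝ E] {m : ℝ} (hm : 0 < m) {f : E → ℝ}
    {f' : E → E} (hf : QuadLower m f f') (hc : Continuous f) : ∃ u, ∀ v, f u ≤ f v := by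
  apply hc.exists_forall_le
  have h1 : Filter.Tendsto (fun v : E => ‖v‖ * (m / 2 * ‖v‖ - ‖f' 0‖) + f 0)
      (Filter.cocompact E) Filter.atTop := by
    have h2 := tendsto_norm_cocompact_atTop (E := E)
    refine Filter.tendsto_atTop_add_const_right _ _ (h2.atTop_mul_atTop₀ ?_)
    exact Filter.tendsto_atTop_add_const_right _ _ (h2.const_mul_atTop (by positivity))
  refine Filter.tendsto_atTop_mono (fun v => ?_) h1
  have h2 := hf 0 v
  have h3 := neg_le_of_abs_le (abs_real_inner_le_norm (f' 0) (v - 0))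
  rw [sub_zero] at h2 h3
  nlinarith

end QuadraticBounds

/-! ### Rules for results and call counts of oracle programs -/

namespace OracleProg

variable {E α β : Type} {oh og : E → E}

/-- The program `p` returns a value satisfying `P` after at most `a` calls for `h` and at most `b`
calls for `g`. -/
def RunsTo (oh og : E → E) (p : OracleProg E α) (P : α → Prop) (a b : ℕ) : Prop :=
  ∃ r, p.run oh og = some r ∧ P r.output ∧ r.hCalls ≤ a ∧ r.gCalls ≤ b

theorem run_bind (p : OracleProg E α) (f : α → OracleProg E β) :
    (p >>= f).run oh og = (p.run oh og).bind fun r =>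
      ((f r.output).run oh og).map fun s => ⟨s.output, r.hCalls + s.hCalls, r.gCalls + s.gCalls⟩ := by
  change (p.andThen f).run oh og = _
  induction p with
  | ret a => simp [andThen, run]
  | abort => simp [andThen, run]
  | callH x k ih =>
    simp [andThen, run, ih, Option.bind_map, Option.map_bind, Function.comp_def, add_right_comm]
  | callG x k ih =>
    simp [andThen, run, ih, Option.bind_map, Option.map_bind, Function.comp_def, add_right_comm]

theorem RunsTo.pure {P : α → Prop} {x : α} (h : P x) (a b : ℕ) :
    RunsTo oh og (Pure.pure x : OracleProg E α) P a b :=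
  ⟨⟨x, 0, 0⟩, rfl, h, Nat.zero_le _, Nat.zero_le _⟩

theorem RunsTo.mono {p : OracleProg E α} {P Q : α → Prop} {a b a' b' : ℕ}
    (hp : RunsTo oh og p P a b) (h : ∀ x, P x → Q x) (ha : a ≤ a') (hb : b ≤ b') :
    RunsTo oh og p Q a' b' := by
  obtain ⟨r, h1, h2, h3, h4⟩ := hp
  exact ⟨r, h1, h _ h2, h3.trans ha, h4.trans hb⟩

theorem RunsTo.bind {p : OracleProg E α} {f : α → OracleProg E β} {P : α → Prop} {Q : β → Prop}
    {a b a' b' : ℕ} (hp : RunsTo oh og p P a b)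
    (hf : ∀ x, P x → RunsTo oh og (f x) Q a' b') :
    RunsTo oh og (p >>= f) Q (a + a') (b + b') := by
  obtain ⟨r, h1, h2, h3, h4⟩ := hp
  obtain ⟨s, k1, k2, k3, k4⟩ := hf _ h2
  exact ⟨⟨s.output, r.hCalls + s.hCalls, r.gCalls + s.gCalls⟩, by simp [run_bind, h1, k1], k2,
    add_le_add h3 k3, add_le_add h4 k4⟩

theorem RunsTo.gradH_bind {f : E → OracleProg E β} {Q : β → Prop} {a b : ℕ} {x : E}
    (hf : RunsTo oh og (f (oh x)) Q a b) : RunsTo oh og (gradH x >>= f) Q (a + 1) b := by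
  obtain ⟨r, h1, h2, h3, h4⟩ := hf
  refine ⟨⟨r.output, r.hCalls + 1, r.gCalls⟩, ?_, h2, Nat.succ_le_succ h3, h4⟩
  simp [run_bind, gradH, run, h1, add_comm]

theorem RunsTo.gradG_bind {f : E → OracleProg E β} {Q : β → Prop} {a b : ℕ} {x : E}
    (hf : RunsTo oh og (f (og x)) Q a b) : RunsTo oh og (gradG x >>= f) Q a (b + 1) := by
  obtain ⟨r, h1, h2, h3, h4⟩ := hf
  refine ⟨⟨r.output, r.hCalls, r.gCalls + 1⟩, ?_, h2, h3, Nat.succ_le_succ h4⟩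
  simp [run_bind, gradG, run, h1, add_comm]

end OracleProg

/-! ### Convergence of the two accelerated gradient methods -/

section AcceleratedGradient

variable {E : Type} [NormedAddCommGroup E] [InnerProductSpace ℝ E]

/-- One step of the accelerated gradient method contracts the Lyapunov function. -/
theorem agmWhole_lyapunov_step {σ M q : ℝ} (hσ : 0 < σ) (hM : 0 < M) (hq0 : 0 ≤ q) (hq1 : q ≤ 1)
    (hq : q ^ 2 * M = σ) {φ : E → ℝ} {φ' : E → E} (hl : QuadLower σ φ φ') (hu : QuadUpper M φ φ')
    (u : E) {x y v : E} (hy : (1 + q) • y = x + q • v) :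
    φ (y - (1 / M) • φ' y) - φ u + σ / 2 * ‖(1 - q) • v + q • y - (q / σ) • φ' y - u‖ ^ 2 ≤
      (1 - q) * (φ x - φ u + σ / 2 * ‖v - u‖ ^ 2) := by
  set D := φ' y with hD
  have h1 := hu y (y - (1 / M) • D)
  rw [← hD, sub_sub_cancel_left, inner_neg_right, inner_smul_right, real_inner_self_eq_norm_sq,
    norm_neg, norm_smul, Real.norm_of_nonneg (by positivity), mul_pow] at h1
  have h2 := hl y x
  have h3 := hl y u
  set p := v - u with hp
  set w := y - u with hw
  have e1 : x - y = q • (w - p) := by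
    have : x = (1 + q) • y - q • v := by rw [hy]; simp
    rw [this, hp, hw]; module
  rw [← hD, e1, inner_smul_right, inner_sub_right] at h2
  rw [← hD, ← neg_sub y u, ← hw, inner_neg_right, norm_neg] at h3
  have e2 : (1 - q) • v + q • y - (q / σ) • D - u = (1 - q) • p + q • w - (q / σ) • D := by
    rw [hp, hw]; module
  have e3 : ‖(1 - q) • p + q • w - (q / σ) • D‖ ^ 2 = (1 - q) * ‖p‖ ^ 2 + q * ‖w‖ ^ 2
      - q * (1 - q) * ‖p - w‖ ^ 2
      - 2 * (q / σ) * ((1 - q) * inner ℝ D p + q * inner ℝ D w) + (q / σ) ^ 2 * ‖D‖ ^ 2 := by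
    rw [norm_sub_sq_real _ ((q / σ) • D), norm_add_sq_real, norm_sub_sq_real p w]
    simp only [norm_smul, mul_pow, Real.norm_eq_abs, sq_abs, inner_add_right, inner_smul_left,
      inner_smul_right, real_inner_comm D, RCLike.conj_to_real]
    ring
  have h4 : 0 ≤ σ / 2 * ‖x - y‖ ^ 2 := by positivity
  rw [e1] at h4
  have h5 : 0 ≤ σ / 2 * (q * (1 - q) * ‖p - w‖ ^ 2) := by
    have := sub_nonneg.2 hq1
    positivity
  -- The relation `q ^ 2 * M = σ` makes the gradient term of the new distance equal to the decrease
  -- `‖D‖ ^ 2 / (2 * M)` of the gradient step, so the two cancel.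
  have h6 : σ / 2 * (q / σ) ^ 2 = 1 / (2 * M) := by
    rw [← hq]; rcases eq_or_ne q 0 with h | h
    · simp [h] at hq; linarith
    · field_simp
  have h7 : M / 2 * ((1 / M) ^ 2 * ‖D‖ ^ 2) = 1 / (2 * M) * ‖D‖ ^ 2 := by field_simp
  have h8 : 1 / M * ‖D‖ ^ 2 = 2 * (1 / (2 * M) * ‖D‖ ^ 2) := by field_simp
  have h9 : σ / 2 * (2 * (q / σ) * ((1 - q) * inner ℝ D p + q * inner ℝ D w)) =
      q * ((1 - q) * inner ℝ D p + q * inner ℝ D w) := by field_simp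
  have k2 := mul_le_mul_of_nonneg_left h2 (sub_nonneg.2 hq1)
  have k3 := mul_le_mul_of_nonneg_left h3 hq0
  have k4 := mul_nonneg (sub_nonneg.2 hq1) h4
  rw [e2, e3]
  have h10 : σ / 2 * ((q / σ) ^ 2 * ‖D‖ ^ 2) = 1 / (2 * M) * ‖D‖ ^ 2 := by rw [← mul_assoc, h6]
  linarith

/-- The sequence `v` of the Lyapunov function is never computed by the program. It is recovered from
`(1 + q) • y = x + q • v`, which the momentum step preserves because its coefficient is `(1 - q) /
(1 + q)`. -/
theorem runsTo_agmWhole {oh g' : E → E} {b : E} {α σ M q : ℝ} (hσ : 0 < σ) (hM : 0 < M)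
    (hq : q = √σ / √M) (hq1 : q ≤ 1) {φ : E → ℝ}
    (hl : QuadLower σ φ (fun v => g' v + (b + α • v)))
    (hu : QuadUpper M φ (fun v => g' v + (b + α • v))) (u : E) (N : ℕ) (x y v : E)
    (hy : (1 + q) • y = x + q • v) :
    RunsTo oh g' (agmWhole b α M σ N x y)
      (fun r => φ r - φ u ≤ (1 - q) ^ N * (φ x - φ u + σ / 2 * ‖v - u‖ ^ 2)) 0 N := by
  have hq0 : 0 < q := by rw [hq]; positivity
  have hqM : q ^ 2 * M = σ := by
    rw [hq, div_pow, Real.sq_sqrt hσ.le, Real.sq_sqrt hM.le]; field_simp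
  induction N generalizing x y v with
  | zero =>
    refine RunsTo.pure ?_ _ _
    rw [pow_zero, one_mul]
    have : 0 ≤ σ / 2 * ‖v - u‖ ^ 2 := by positivity
    linarith
  | succ N ih =>
    refine RunsTo.gradG_bind ?_
    have hstep := agmWhole_lyapunov_step hσ hM hq0.le hq1 hqM hl hu u hy
    simp only [← add_assoc] at hstep
    set x' := y - (1 / M) • (g' y + b + α • y) with hx'
    set v' := (1 - q) • v + q • y - (q / σ) • (g' y + b + α • y) with hv'
    have hβ : (√M - √σ) / (√M + √σ) = (1 - q) / (1 + q) := by
      have : 0 < √M := by positivity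
      rw [hq]; field_simp
    refine (ih x' _ v' ?_).mono (fun r hr => hr.trans ?_) le_rfl le_rfl
    · have e1 : q • v = (1 + q) • y - x := by rw [hy]; simp
      have e2 : q • v' = (1 - q) • (q • v) + q ^ 2 • y - (1 / M) • (g' y + b + α • y) := by
        have : 1 / M = q * (q / σ) := by rw [← hqM]; field_simp
        rw [hv', this]; module
      rw [hβ, smul_add, smul_smul, mul_div_cancel₀ _ (by positivity), e2, e1, hx']
      module
    · rw [pow_succ (1 - q) N, mul_assoc]
      exact mul_le_mul_of_nonneg_left hstep (pow_nonneg (by linarith) _)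

/-- One step of the composite method does not increase the potential. -/
theorem agmComposite_potential_step {α M A a : ℝ} (hα : 0 ≤ α) (hM : 0 < M) (hA : 0 ≤ A)
    (ha : 0 ≤ a) (haA : a ^ 2 * M = 2 * (1 + α * A) * (A + a)) {b : E} {g : E → ℝ} {g' : E → E}
    (hl : QuadLower 0 g g') (hu : QuadUpper M g g') {φ : E → ℝ}
    (hφ : ∀ v, φ v = g v + (inner ℝ b v + α / 2 * ‖v‖ ^ 2)) (u : E) {x y v x' v' : E}
    (hy : (A + a) • y = A • x + a • v) (hx' : (M + α) • x' = M • y - g' y - b)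
    (hv' : (1 + α * (A + a)) • v' = (1 + α * A) • v - a • (g' x' + b)) :
    (A + a) * (φ x' - φ u) + (1 + α * (A + a)) / 2 * ‖u - v'‖ ^ 2 ≤
      A * (φ x - φ u) + (1 + α * A) / 2 * ‖u - v‖ ^ 2 := by
  set e := g' x' with he
  set D := e + b + α • x' with hD
  have hp : 0 < 1 + α * A := by positivity
  have f1 : φ x' + inner ℝ D (x - x') ≤ φ x := by
    have h1 := hl x' x
    have h2 := linear_add_sq_eq b x' x α
    have h3 : 0 ≤ α / 2 * ‖x - x'‖ ^ 2 := by positivity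
    rw [hφ, hφ, h2, hD, add_assoc e, inner_add_left]
    linarith
  have f2 : φ x' + (inner ℝ e (u - x') + inner ℝ b u + α / 2 * ‖u‖ ^ 2
      - (inner ℝ b x' + α / 2 * ‖x'‖ ^ 2)) ≤ φ u := by
    have h1 := hl x' u
    rw [hφ, hφ]
    linarith
  have f3 : inner ℝ b x' + α / 2 * ‖x'‖ ^ 2 + inner ℝ D (v' - x') - inner ℝ e (v' - x') ≤
      inner ℝ b v' + α / 2 * ‖v'‖ ^ 2 := by
    have h2 := linear_add_sq_eq b x' v' α
    have h3 : 0 ≤ α / 2 * ‖v' - x'‖ ^ 2 := by positivity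
    rw [h2, hD, add_assoc e, inner_add_left]
    linarith
  -- `D` is the gradient of `φ` at `x'`. The proximal step writes it as `(e - g' y) + M • (y - x')`,
  -- and cocoercivity absorbs the cross term.
  have f4 : ‖D‖ ^ 2 ≤ M * inner ℝ D (y - x') := by
    have h1 := inner_sub_gradient_ge hM hl hu y x'
    have h2 : D = (e - g' y) + M • (y - x') := by
      have : M • y = (M + α) • x' + g' y + b := by rw [hx']; abel
      rw [hD, smul_sub, this]; module
    rw [← he, ← neg_sub y x', inner_neg_right] at h1
    rw [h2, norm_add_sq_real, inner_add_left]
    simp only [norm_smul, mul_pow, Real.norm_eq_abs, sq_abs, inner_smul_left, inner_smul_right,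
      real_inner_self_eq_norm_sq, RCLike.conj_to_real]
    nlinarith
  -- The estimating function is quadratic with minimizer `v'`, so its value at `u` exceeds that at
  -- `v'` by exactly the squared distance term.
  have f5 : (1 + α * A) / 2 * ‖u - v‖ ^ 2 - (1 + α * A) / 2 * ‖v' - v‖ ^ 2
      + a * (inner ℝ e (u - v') + (inner ℝ b u + α / 2 * ‖u‖ ^ 2)
        - (inner ℝ b v' + α / 2 * ‖v'‖ ^ 2)) = (1 + α * (A + a)) / 2 * ‖u - v'‖ ^ 2 := by
    have h1 := linear_add_sq_eq b v' u α
    have h2 : u - v = (u - v') + (v' - v) := by abel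
    have h3 : inner ℝ (u - v') ((1 + α * (A + a)) • v') =
        inner ℝ (u - v') ((1 + α * A) • v - a • (e + b)) := by rw [hv']
    rw [h1, h2, norm_add_sq_real]
    simp only [inner_sub_right (u - v'), inner_add_right, inner_smul_right,
      real_inner_comm (u - v')] at h3 ⊢
    linear_combination h3
  have f6 : (A + a) * inner ℝ D (y - x') + a * inner ℝ D (v' - v) =
      A * inner ℝ D (x - x') + a * inner ℝ D (v' - x') := by
    have h1 : inner ℝ D ((A + a) • y) = inner ℝ D (A • x + a • v) := by rw [hy]
    simp only [inner_sub_right, inner_add_right, inner_smul_right] at h1 ⊢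
    linear_combination h1
  -- Completing the square; the equation for `a` is exactly what lets `f4` replace `a ^ 2 * ‖D‖ ^
  -- 2`.
  have f7 : 0 ≤ (A + a) * inner ℝ D (y - x') + a * inner ℝ D (v' - v)
      + (1 + α * A) / 2 * ‖v' - v‖ ^ 2 := by
    have h1 : 0 ≤ ‖a • D + (1 + α * A) • (v' - v)‖ ^ 2 := sq_nonneg _
    rw [norm_add_sq_real] at h1
    simp only [norm_smul, mul_pow, Real.norm_eq_abs, sq_abs, inner_smul_left, inner_smul_right,
      RCLike.conj_to_real] at h1
    have h2 := mul_le_mul_of_nonneg_left f4 (sq_nonneg a)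
    have h3 : a ^ 2 * (M * inner ℝ D (y - x')) =
        2 * (1 + α * A) * ((A + a) * inner ℝ D (y - x')) := by
      rw [← mul_assoc, haA]; ring
    rw [h3] at h2
    have h4 : 0 ≤ 2 * (1 + α * A) * ((A + a) * inner ℝ D (y - x') + a * inner ℝ D (v' - v)
      + (1 + α * A) / 2 * ‖v' - v‖ ^ 2) := by nlinarith
    exact nonneg_of_mul_nonneg_right h4 (by positivity)
  have g1 := mul_le_mul_of_nonneg_left f1 hA
  have g2 := mul_le_mul_of_nonneg_left f2 ha
  have g3 := mul_le_mul_of_nonneg_left f3 ha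
  rw [← f5]
  simp only [inner_sub_right] at *
  linarith

theorem agmComposite_coefficient {α M A q a : ℝ} (hα : 0 ≤ α) (hM : 0 < M) (hA : 0 ≤ A)
    (hq : q = (1 + α * A) / M) (ha : a = q + √(q ^ 2 + 2 * q * A)) :
    0 < a ∧ a ^ 2 * M = 2 * (1 + α * A) * (A + a) ∧ A * (1 + √(2 * α / M)) ≤ A + a ∧
      2 / M ≤ A + a := by
  have hq0 : 0 < q := by rw [hq]; positivity
  have hs : √(q ^ 2 + 2 * q * A) ^ 2 = q ^ 2 + 2 * q * A := Real.sq_sqrt (by positivity)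
  have hqM : q * M = 1 + α * A := by rw [hq]; field_simp
  have ha0 : 0 < a := by rw [ha]; positivity
  refine ⟨ha0, ?_, ?_, ?_⟩
  · rw [← hqM]
    have : a ^ 2 = 2 * q * (A + a) := by rw [ha]; linear_combination hs
    rw [this]; ring
  · have h1 : √(2 * α / M) * A ≤ √(q ^ 2 + 2 * q * A) := by
      apply Real.le_sqrt_of_sq_le
      rw [mul_pow, Real.sq_sqrt (by positivity)]
      have h2 : α * A / M ≤ q := by
        rw [hq]; gcongr; linarith
      have h3 : 2 * α / M * A ^ 2 = 2 * (α * A / M) * A := by ring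
      rw [h3]
      nlinarith [mul_le_mul_of_nonneg_right h2 hA, sq_nonneg q]
    linarith
  · have h1 : q ≤ √(q ^ 2 + 2 * q * A) := Real.le_sqrt_of_sq_le (by nlinarith)
    have h2 : 1 / M ≤ q := by rw [hq]; gcongr; nlinarith
    have h3 : 2 / M = 1 / M + 1 / M := by ring
    linarith

/-- The final weight `A'` has two lower bounds because the geometric one is void for the starting
value `A = 0`. There the first step supplies `2 / M`, and only the remaining `N - 1` steps count. -/
theorem runsTo_agmComposite_aux {oh g' : E → E} {b : E} {α M : ℝ} (hα : 0 ≤ α) (hM : 0 < M)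
    {g φ : E → ℝ} (hl : QuadLower 0 g g') (hu : QuadUpper M g g')
    (hφ : ∀ v, φ v = g v + (inner ℝ b v + α / 2 * ‖v‖ ^ 2)) (u v₀ : E) (N : ℕ) (A : ℝ) (s x : E)
    (hA : 0 ≤ A) :
    RunsTo oh g' (agmComposite b α M v₀ N A s x)
      (fun r => ∃ A', A * (1 + √(2 * α / M)) ^ N ≤ A' ∧
        (1 ≤ N → 2 / M * (1 + √(2 * α / M)) ^ (N - 1) ≤ A') ∧
        A' * (φ r - φ u) ≤
          A * (φ x - φ u) + (1 + α * A) / 2 * ‖u - (1 / (1 + α * A)) • (v₀ - s)‖ ^ 2) 0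
        (2 * N) := by
  induction N generalizing A s x with
  | zero =>
    refine RunsTo.pure ⟨A, by simp, by simp, ?_⟩ _ _
    have : 0 ≤ (1 + α * A) / 2 * ‖u - (1 / (1 + α * A)) • (v₀ - s)‖ ^ 2 := by positivity
    linarith
  | succ N ih =>
    refine RunsTo.gradG_bind (RunsTo.gradG_bind ?_)
    set v := (1 / (1 + α * A)) • (v₀ - s) with hv
    set q := (1 + α * A) / M with hq
    set a := q + √(q ^ 2 + 2 * q * A) with ha
    set y := (A / (A + a)) • x + (a / (A + a)) • v with hy
    set x' := (1 / (M + α)) • (M • y - g' y - b) with hx'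
    obtain ⟨ha0, haA, hgrow, hfirst⟩ := agmComposite_coefficient hα hM hA hq ha
    have hAa : 0 < A + a := by positivity
    have hstep := agmComposite_potential_step (x := x) (y := y) (v := v) (x' := x')
      (v' := (1 / (1 + α * (A + a))) • (v₀ - (s + a • (g' x' + b)))) hα hM hA ha0.le haA hl hu hφ u
      (by rw [hy, smul_add, smul_smul, smul_smul]; field_simp)
      (by rw [hx', smul_smul]; field_simp; rw [one_smul])
      (by
        have h1 : 1 + α * (A + a) ≠ 0 := by positivity
        have h2 : 1 + α * A ≠ 0 := by positivity
        rw [hv, smul_smul, smul_smul, mul_one_div_cancel h1, mul_one_div_cancel h2]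
        module)
    refine (ih (A + a) (s + a • (g' x' + b)) x' hAa.le).mono ?_ le_rfl le_rfl
    rintro r ⟨A', h1, -, h3⟩
    have hpow : 0 ≤ (1 + √(2 * α / M)) ^ N := by positivity
    refine ⟨A', ?_, fun _ => ?_, h3.trans hstep⟩
    · rw [pow_succ', ← mul_assoc]
      exact (mul_le_mul_of_nonneg_right hgrow hpow).trans h1
    · exact (mul_le_mul_of_nonneg_right hfirst hpow).trans h1

theorem runsTo_agmComposite {oh g' : E → E} {b : E} {α M : ℝ} (hα : 0 ≤ α) (hM : 0 < M)
    {g φ : E → ℝ} (hl : QuadLower 0 g g') (hu : QuadUpper M g g')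
    (hφ : ∀ v, φ v = g v + (inner ℝ b v + α / 2 * ‖v‖ ^ 2)) {u : E} (hmin : ∀ v, φ u ≤ φ v)
    (v₀ : E) {N : ℕ} (hN : 1 ≤ N) :
    RunsTo oh g' (agmComposite b α M v₀ N 0 0 v₀)
      (fun r => (1 + √(2 * α / M)) ^ (N - 1) * (φ r - φ u) ≤ M / 4 * ‖v₀ - u‖ ^ 2) 0 (2 * N) := by
  refine (runsTo_agmComposite_aux hα hM hl hu hφ u v₀ N 0 0 v₀ le_rfl).mono ?_ le_rfl le_rfl
  rintro r ⟨A', -, h2, h3⟩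
  have h4 := (mul_le_mul_of_nonneg_right (h2 hN) (sub_nonneg.2 (hmin r))).trans h3
  simp only [zero_mul, mul_zero, add_zero, div_one, one_smul, sub_zero, zero_add,
    norm_sub_rev u] at h4
  calc _ = M / 2 * (2 / M * (1 + √(2 * α / M)) ^ (N - 1) * (φ r - φ u)) := by field_simp
    _ ≤ M / 2 * (1 / 2 * ‖v₀ - u‖ ^ 2) := mul_le_mul_of_nonneg_left h4 (by positivity)
    _ = _ := by ring

end AcceleratedGradient

/-! ### Accuracy of the inner method -/

section InnerMethodBounds

variable {E : Type} [NormedAddCommGroup E] [InnerProductSpace ℝ E]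

theorem runsTo_innerAGM {oh g' : E → E} {m : InnerMethod} {b : E} {L Lg : ℝ} (hL : 0 < L)
    (hLg : L ≤ Lg) {g φ : E → ℝ} (hu : QuadUpper Lg g g')
    (hconv : m = InnerMethod.composite → QuadLower 0 g g')
    (hφ : ∀ v, φ v = g v + (inner ℝ b v + (L + L) / 2 * ‖v‖ ^ 2))
    (hlφ : QuadLower L φ (fun v => g' v + (b + (L + L) • v)))
    (huφ : QuadUpper (Lg + (L + L)) φ (fun v => g' v + (b + (L + L) • v)))
    {u : E} (hmin : ∀ v, φ u ≤ φ v) (v₀ : E) {N : ℕ} (hN : 1 ≤ N) :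
    RunsTo oh g' (innerAGM m Lg b (L + L) L N v₀)
      (fun r => φ r - φ u ≤ 2 * Lg * Real.exp (-(N * √(L / Lg) / 2)) * ‖v₀ - u‖ ^ 2) 0
        (2 * N) := by
  have hLg0 : 0 < Lg := hL.trans_le hLg
  set t := √(L / Lg) with ht
  have ht0 : 0 < t := by positivity
  have ht2 : t ^ 2 = L / Lg := Real.sq_sqrt (by positivity)
  have ht1 : t ≤ 1 := Real.sqrt_le_one.2 ((div_le_one hLg0).2 hLg)
  cases m with
  | whole =>
    have hM : 0 < Lg + (L + L) := by positivity
    set q := √L / √(Lg + (L + L)) with hq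
    have hq1 : q ≤ 1 := div_le_one_of_le₀ (Real.sqrt_le_sqrt (by linarith)) (by positivity)
    have hqt : t / 2 ≤ q := by
      rw [hq, ← Real.sqrt_div hL.le]
      -- Since `L ≤ Lg`, the smoothness constant `Lg + 2 * L` is at most `4 * Lg`.
      apply Real.le_sqrt_of_sq_le
      rw [div_pow, ht2, div_div, div_le_div_iff_of_pos_left hL (by positivity) hM]
      linarith
    refine (runsTo_agmWhole hL hM hq hq1 hlφ huφ u N v₀ v₀ v₀ (by module)).mono
      (fun r hr => hr.trans ?_) le_rfl (by omega)
    have h1 : (1 - q) ^ N ≤ Real.exp (-(N * t / 2)) := by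
      calc (1 - q) ^ N ≤ Real.exp (-q) ^ N :=
            pow_le_pow_left₀ (by linarith) (Real.one_sub_le_exp_neg q) N
        _ = Real.exp (N * -q) := (Real.exp_nat_mul _ _).symm
        _ ≤ _ := by
            apply Real.exp_le_exp.2
            have : (N : ℝ) * (t / 2) ≤ N * q := by gcongr
            linarith
    have h2 := huφ u v₀
    simp only [huφ.gradient_eq_zero hM hmin, inner_zero_left, add_zero] at h2
    have h3 : φ v₀ - φ u + L / 2 * ‖v₀ - u‖ ^ 2 ≤ 2 * Lg * ‖v₀ - u‖ ^ 2 := by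
      nlinarith [sq_nonneg ‖v₀ - u‖]
    calc _ ≤ Real.exp (-(N * t / 2)) * (2 * Lg * ‖v₀ - u‖ ^ 2) :=
          mul_le_mul h1 h3 (add_nonneg (sub_nonneg.2 (hmin v₀)) (by positivity)) (by positivity)
      _ = _ := by ring
  | composite =>
    refine (runsTo_agmComposite (by positivity) hLg0 (hconv rfl) hu hφ hmin v₀ hN).mono
      (fun r hr => ?_) le_rfl le_rfl
    have hs : √(2 * (L + L) / Lg) = 2 * t := by
      rw [show 2 * (L + L) / Lg = 2 ^ 2 * (L / Lg) by ring, Real.sqrt_mul (by positivity),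
        Real.sqrt_sq (by norm_num)]
    rw [hs] at hr
    have hΔ := sub_nonneg.2 (hmin r)
    -- For `0 ≤ t ≤ 1`, `(1 + 2 * t) * (1 - t / 2) = 1 + 3 * t / 2 - t ^ 2 ≥ 1`.
    have h1 : 1 ≤ ((1 + 2 * t) * Real.exp (-(t / 2))) ^ N := by
      apply one_le_pow₀
      have := Real.one_sub_le_exp_neg (t / 2)
      nlinarith
    have h2 : (1 + 2 * t) ^ N * (φ r - φ u) ≤ 2 * Lg * ‖v₀ - u‖ ^ 2 := by
      obtain ⟨n, rfl⟩ : ∃ n, N = n + 1 := ⟨N - 1, by omega⟩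
      rw [Nat.add_sub_cancel] at hr
      have h3 := mul_le_mul_of_nonneg_left hr (show 0 ≤ 1 + 2 * t by positivity)
      rw [pow_succ', mul_assoc]
      refine h3.trans ?_
      have h4 : 0 ≤ Lg / 4 * ‖v₀ - u‖ ^ 2 := by positivity
      nlinarith
    have h5 : Real.exp (-(N * t / 2)) = Real.exp (-(t / 2)) ^ N := by
      rw [← Real.exp_nat_mul]; congr 1; ring
    calc φ r - φ u ≤ ((1 + 2 * t) * Real.exp (-(t / 2))) ^ N * (φ r - φ u) :=
          le_mul_of_one_le_left hΔ h1
      _ = Real.exp (-(t / 2)) ^ N * ((1 + 2 * t) ^ N * (φ r - φ u)) := by rw [mul_pow]; ring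
      _ ≤ Real.exp (-(t / 2)) ^ N * (2 * Lg * ‖v₀ - u‖ ^ 2) := by gcongr
      _ = _ := by rw [h5]; ring

/-- The factor 24 makes the exponent at most `-12 - 2 * l`: the logarithm pays for `(L / Lg) ^ 2`,
and `exp (-12) ≤ 2 ^ (-12)` covers the constants, as `12 / 4096 ≤ 1 / 256`. -/
theorem innerSteps_exp_le {L Lg : ℝ} (hL : 0 < L) (hLg : L ≤ Lg) :
    1 ≤ innerSteps 24 L Lg ∧
      12 * Lg ^ 2 * Real.exp (-(innerSteps 24 L Lg * √(L / Lg) / 2)) ≤ (L / 16) ^ 2 := by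
  have hLg0 : 0 < Lg := hL.trans_le hLg
  have hlog : 0 ≤ Real.log (Lg / L) := Real.log_nonneg ((one_le_div hL).2 hLg)
  set l := Real.log (Lg / L) with hl
  have hN : 24 * √(Lg / L) * (1 + l) ≤ innerSteps 24 L Lg := Nat.le_ceil _
  have hpos : 0 < 24 * √(Lg / L) * (1 + l) := by positivity
  refine ⟨Nat.one_le_iff_ne_zero.2 (Nat.ceil_pos.2 hpos).ne', ?_⟩
  have hprod : √(Lg / L) * √(L / Lg) = 1 := by
    rw [← Real.sqrt_mul (by positivity), div_mul_div_cancel₀ hL.ne', div_self hLg0.ne',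
      Real.sqrt_one]
  have h1 : 24 * (1 + l) ≤ innerSteps 24 L Lg * √(L / Lg) := by
    calc 24 * (1 + l) = 24 * √(Lg / L) * (1 + l) * √(L / Lg) := by
          linear_combination (-24 * (1 + l)) * hprod
      _ ≤ _ := mul_le_mul_of_nonneg_right hN (Real.sqrt_nonneg _)
  have h2 : Real.exp (-(innerSteps 24 L Lg * √(L / Lg) / 2)) ≤ 1 / 4096 * (L / Lg) ^ 2 := by
    have h3 : Real.exp (-l) = L / Lg := by
      rw [Real.exp_neg, hl, Real.exp_log (by positivity), inv_div]
    have h4 : Real.exp (-12) ≤ 1 / 4096 := by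
      have h5 : (2 : ℝ) ^ 12 ≤ Real.exp 1 ^ 12 :=
        pow_le_pow_left₀ (by norm_num) (by linarith [Real.add_one_le_exp 1]) 12
      rw [← Real.exp_nat_mul] at h5
      rw [Real.exp_neg, ← one_div]
      apply one_div_le_one_div_of_le (by norm_num)
      norm_num at h5 ⊢
      exact h5
    calc _ ≤ Real.exp (-12 + (2 : ℕ) * -l) := by
          apply Real.exp_le_exp.2
          push_cast
          linarith
      _ = Real.exp (-12) * (L / Lg) ^ 2 := by rw [Real.exp_add, Real.exp_nat_mul, h3]
      _ ≤ _ := by gcongr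
  calc _ ≤ 12 * Lg ^ 2 * (1 / 4096 * (L / Lg) ^ 2) := by gcongr
    _ = 12 / 4096 * L ^ 2 := by field_simp
    _ ≤ _ := by nlinarith [sq_nonneg L]

end InnerMethodBounds

/-! ### When the stopping test of the middle loop succeeds -/

section MiddleStep

variable {E : Type} [NormedAddCommGroup E]

/-- What one iteration of the middle loop achieves, from `ζ` to `r`; here `F` is the objective of
the middle loop, with gradient `F'` and minimizer `zs`. -/
structure MiddleStep (L : ℝ) (F : E → ℝ) (F' : E → E) (ζ₀ zs ζ r : E) : Prop where
  contract : F r - F zs ≤ 3 / 4 * (F ζ - F zs)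
  first : ζ = ζ₀ → F r - F zs ≤ 2 * L * ‖ζ₀ - zs‖ ^ 2
  gradient : ∃ d, 0 ≤ d ∧ L / 2 * d ^ 2 ≤ F ζ - F zs ∧ ‖F' r‖ ≤ L / 16 * d + 2 * L * ‖r - ζ‖

/-- Near the minimizer the stopping test of the middle loop succeeds. -/
theorem MiddleStep.test {L : ℝ} {F : E → ℝ} {F' : E → E} {ζ₀ zs ζ r : E} (hL : 0 < L)
    (hs : MiddleStep L F F' ζ₀ zs ζ r) (hF : ∀ v, F zs + L / 2 * ‖v - zs‖ ^ 2 ≤ F v)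
    (hζ : F ζ - F zs ≤ L * ‖ζ₀ - zs‖ ^ 2 / 200) : ‖F' r‖ ≤ L / 2 * ‖r - ζ₀‖ := by
  obtain ⟨d, hd0, hd, hr⟩ := hs.gradient
  have hc := hs.contract
  set D := ‖ζ₀ - zs‖ with hD
  have hD0 : 0 ≤ D := norm_nonneg _
  -- The threshold `1 / 200` is `1 / 2 * (1 / 10) ^ 2`. With all three lengths at most `D / 10`, the
  -- gradient is at most `(1 / 160 + 4 / 10) * L * D`, while the test allows at least `9 / 20 * L *
  -- D`.
  have small : ∀ a : ℝ, L / 2 * a ^ 2 ≤ F ζ - F zs → a ≤ D / 10 := by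
    intro a ha
    have : L / 2 * a ^ 2 ≤ L / 2 * (D / 10) ^ 2 := by linarith
    exact le_of_sq_le_sq (le_of_mul_le_mul_left this (by positivity)) (by positivity)
  have h0 : 0 ≤ F ζ - F zs := le_trans (by positivity) hd
  have h1 := small d hd
  have h2 := small ‖ζ - zs‖ (by linarith [hF ζ])
  have h3 := small ‖r - zs‖ (by linarith [hF r])
  have h4 : ‖r - ζ‖ ≤ ‖r - zs‖ + ‖ζ - zs‖ := by
    rw [norm_sub_rev ζ]; exact norm_sub_le_norm_sub_add_norm_sub _ _ _
  have h5 : D ≤ ‖r - ζ₀‖ + ‖r - zs‖ := by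
    rw [hD, norm_sub_rev r ζ₀]; exact norm_sub_le_norm_sub_add_norm_sub _ _ _
  calc ‖F' r‖ ≤ L / 16 * d + 2 * L * ‖r - ζ‖ := hr
    _ = L * (d / 16 + 2 * ‖r - ζ‖) := by ring
    _ ≤ L * (1 / 2 * ‖r - ζ₀‖) := mul_le_mul_of_nonneg_left (by linarith) hL.le
    _ = _ := by ring

end MiddleStep

/-! ### One iteration of the middle loop -/

section MiddleLoop

variable {E : Type} [NormedAddCommGroup E] [InnerProductSpace ℝ E]

/-- The standing assumptions on `h` and `g`, with gradient maps `h'` and `g'`: both are smooth and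
their sum is convex. -/
structure SmoothSum (L Lg : ℝ) (h g : E → ℝ) (h' g' : E → E) : Prop where
  pos : 0 < L
  le : L ≤ Lg
  lipschitz : ∀ x y, ‖h' x - h' y‖ ≤ L * ‖x - y‖
  lower_left : QuadLower (-L) h h'
  upper_left : QuadUpper L h h'
  upper_right : QuadUpper Lg g g'
  convex : QuadLower 0 (fun x => h x + g x) (fun x => h' x + g' x)
  continuous_left : Continuous h
  continuous_right : Continuous g

/-- The objective of the middle loop. -/
noncomputable def proxObjective (L : ℝ) (f : E → ℝ) (ζ₀ v : E) : ℝ := f v + L / 2 * ‖v - ζ₀‖ ^ 2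

/-- The objective of the inner method, up to a constant. -/
noncomputable def innerObjective (L : ℝ) (h' : E → E) (g : E → ℝ) (ζ₀ ζ v : E) : ℝ :=
  g v + (inner ℝ (h' ζ - L • ζ₀ - L • ζ) v + (L + L) / 2 * ‖v‖ ^ 2)

variable {L Lg : ℝ} {h g : E → ℝ} {h' g' : E → E}

theorem quadLower_proxObjective {m : ℝ} {f : E → ℝ} {f' : E → E} (hf : QuadLower m f f')
    (ζ₀ : E) : QuadLower (m + L) (proxObjective L f ζ₀) (fun v => f' v + L • (v - ζ₀)) := by
  refine hf.add (g := fun v => L / 2 * ‖v - ζ₀‖ ^ 2) fun x y => ?_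
  have := linear_add_sq_eq 0 (x - ζ₀) (y - ζ₀) L
  simp only [inner_zero_left, zero_add, sub_sub_sub_cancel_right] at this
  exact this.ge

theorem quadUpper_proxObjective {M : ℝ} {f : E → ℝ} {f' : E → E} (hf : QuadUpper M f f')
    (ζ₀ : E) : QuadUpper (M + L) (proxObjective L f ζ₀) (fun v => f' v + L • (v - ζ₀)) := by
  refine hf.add (g := fun v => L / 2 * ‖v - ζ₀‖ ^ 2) fun x y => ?_
  have := linear_add_sq_eq 0 (x - ζ₀) (y - ζ₀) L
  simp only [inner_zero_left, zero_add, sub_sub_sub_cancel_right] at this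
  exact this.le

/-- The inner objective differs by a constant from the model of the middle objective. -/
theorem innerObjective_eq (ζ₀ ζ v : E) :
    innerObjective L h' g ζ₀ ζ v = g v + inner ℝ (h' ζ) (v - ζ) + L / 2 * ‖v - ζ₀‖ ^ 2
      + L / 2 * ‖v - ζ‖ ^ 2 + (inner ℝ (h' ζ) ζ - L / 2 * ‖ζ₀‖ ^ 2 - L / 2 * ‖ζ‖ ^ 2) := by
  rw [innerObjective, norm_sub_sq_real v ζ₀, norm_sub_sq_real v ζ]
  simp only [inner_sub_right, inner_smul_right, real_inner_comm v]
  ring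

theorem SmoothSum.quadUpper_innerObjective (H : SmoothSum L Lg h g h' g') (ζ₀ ζ : E) :
    QuadUpper (Lg + (L + L)) (innerObjective L h' g ζ₀ ζ)
      (fun v => g' v + (h' ζ - L • ζ₀ - L • ζ + (L + L) • v)) :=
  H.upper_right.add fun x y => (linear_add_sq_eq _ x y _).le

/-- By convexity of `h + g`, the curvature of `g` is at least minus that of `h`, hence at least
`-L`; the quadratic term contributes `2 * L`. -/
theorem SmoothSum.quadLower_innerObjective (H : SmoothSum L Lg h g h' g') (ζ₀ ζ : E) :
    QuadLower L (innerObjective L h' g ζ₀ ζ)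
      (fun v => g' v + (h' ζ - L • ζ₀ - L • ζ + (L + L) • v)) := by
  intro x y
  have h1 := H.convex x y
  have h2 := H.upper_left x y
  have h3 := linear_add_sq_eq (h' ζ - L • ζ₀ - L • ζ) x y (L + L)
  rw [inner_add_left] at h1 ⊢
  rw [innerObjective, innerObjective, h3]
  linarith

theorem SmoothSum.prox_le_model (H : SmoothSum L Lg h g h' g') (ζ₀ ζ v : E) :
    proxObjective L (fun x => h x + g x) ζ₀ v - proxObjective L (fun x => h x + g x) ζ₀ ζ ≤
      innerObjective L h' g ζ₀ ζ v - innerObjective L h' g ζ₀ ζ ζ := by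
  have h1 := H.upper_left ζ v
  simp only [innerObjective_eq, proxObjective, sub_self, inner_zero_right, norm_zero]
  linarith

theorem SmoothSum.model_le_prox (H : SmoothSum L Lg h g h' g') (ζ₀ ζ v : E) :
    innerObjective L h' g ζ₀ ζ v - innerObjective L h' g ζ₀ ζ ζ ≤
      proxObjective L (fun x => h x + g x) ζ₀ v - proxObjective L (fun x => h x + g x) ζ₀ ζ
        + L * ‖v - ζ‖ ^ 2 := by
  have h1 := H.lower_left ζ v
  simp only [innerObjective_eq, proxObjective, sub_self, inner_zero_right, norm_zero]
  linarith

/-- The two-sided comparison of `F` with its model transfers near-optimality of `r` for the model to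
`F`. The error `φ r - φ u` is controlled by `‖ζ - u‖ ^ 2`, which is itself controlled by the gap of
`F` at `ζ`. -/
theorem SmoothSum.middleStep (H : SmoothSum L Lg h g h' g') {ζ₀ ζ zs u r : E}
    (hzs : ∀ v, proxObjective L (fun x => h x + g x) ζ₀ zs ≤
      proxObjective L (fun x => h x + g x) ζ₀ v)
    (hmin : ∀ v, innerObjective L h' g ζ₀ ζ u ≤ innerObjective L h' g ζ₀ ζ v)
    (hr : ‖g' r + (h' ζ - L • ζ₀ - L • ζ + (L + L) • r)‖ ≤ L / 16 * ‖ζ - u‖) :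
    MiddleStep L (proxObjective L (fun x => h x + g x) ζ₀)
      (fun v => h' v + g' v + L • (v - ζ₀)) ζ₀ zs ζ r := by
  have hL := H.pos
  have hF := quadLower_proxObjective (L := L) H.convex ζ₀
  rw [zero_add] at hF
  have hA := H.prox_le_model ζ₀ ζ
  have hB := H.model_le_prox ζ₀ ζ
  set F := proxObjective L (fun x => h x + g x) ζ₀ with hFdef
  have hφu := H.quadUpper_innerObjective ζ₀ ζ
  have hφl := H.quadLower_innerObjective ζ₀ ζ
  set φ := innerObjective L h' g ζ₀ ζ with hφ
  have hM : 0 < Lg + (L + L) := by linarith [H.le]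
  have hE := hφl.le_of_gradient_eq_zero (hφu.gradient_eq_zero hM hmin)
  have hD : φ r - φ u ≤ L / 2 * (1 / 256 * ‖ζ - u‖ ^ 2) := by
    refine (hφl.sub_le_norm_sq hL r u).trans ?_
    rw [div_le_iff₀ (by positivity)]
    calc _ ≤ (L / 16 * ‖ζ - u‖) ^ 2 := pow_le_pow_left₀ (norm_nonneg _) hr 2
      _ = _ := by ring
  have hdist : L / 2 * ‖ζ - u‖ ^ 2 ≤ F ζ - F zs := by
    have h1 := hE ζ
    have h2 := hA u
    have h3 := hzs u
    linarith
  refine ⟨?_, ?_, ‖ζ - u‖, norm_nonneg _, hdist, ?_⟩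
  -- At one third of the way to `zs`, the strong convexity gain of `F` is `L / 9 * ‖zs - ζ‖ ^ 2`,
  -- which is exactly the model error `L * ‖w - ζ‖ ^ 2`. What remains is the factor `2 / 3 + 1 / 256
  -- ≤ 3 / 4`.
  · set w := ζ + (1 / 3 : ℝ) • (zs - ζ) with hw
    have e1 : ζ - w = (-(1 / 3) : ℝ) • (zs - ζ) := by rw [hw]; module
    have e2 : zs - w = (2 / 3 : ℝ) • (zs - ζ) := by rw [hw]; module
    have e3 : w - ζ = (1 / 3 : ℝ) • (zs - ζ) := by rw [hw]; module
    have h1 := hF w ζ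
    have h2 := hF w zs
    have h3 := hB w
    have h4 := hmin w
    have h5 := hA r
    rw [e1, inner_smul_right, norm_smul, mul_pow] at h1
    rw [e2, inner_smul_right, norm_smul, mul_pow] at h2
    rw [e3, norm_smul, mul_pow] at h3
    norm_num at h1 h2 h3
    linarith [hzs ζ]
  -- Here the model is compared with `F` at `zs` itself, so the initial gap of `F`, which may be of
  -- order `Lg * ‖ζ - zs‖ ^ 2`, drops out.
  · rintro rfl
    have h1 := hA r
    have h2 := hB zs
    have h3 := hE zs
    have h4 := hA u
    have h5 := hzs u
    rw [norm_sub_rev zs ζ] at h2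
    have h6 : L / 2 * ‖zs - u‖ ^ 2 ≤ L * ‖ζ - zs‖ ^ 2 := by linarith
    have h7 : ‖ζ - u‖ ^ 2 ≤ 2 * ‖ζ - zs‖ ^ 2 + 2 * ‖zs - u‖ ^ 2 := by
      have := norm_sub_le_norm_sub_add_norm_sub ζ zs u
      nlinarith [sq_nonneg (‖ζ - zs‖ - ‖zs - u‖), norm_nonneg (ζ - u)]
    have h8 : 0 ≤ L * ‖ζ - zs‖ ^ 2 := by positivity
    have h9 := mul_le_mul_of_nonneg_left h7 hL.le
    have h10 : 0 ≤ L / 2 * ‖zs - u‖ ^ 2 := by positivity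
    nlinarith
  · have e1 : h' r + g' r + L • (r - ζ₀) =
        (g' r + (h' ζ - L • ζ₀ - L • ζ + (L + L) • r)) + (h' r - h' ζ) - L • (r - ζ) := by
      module
    have h1 := H.lipschitz r ζ
    rw [e1]
    refine (norm_sub_le _ _).trans ?_
    have h2 := norm_add_le (g' r + (h' ζ - L • ζ₀ - L • ζ + (L + L) • r)) (h' r - h' ζ)
    rw [norm_smul, Real.norm_of_nonneg hL.le]
    linarith

end MiddleLoop

/-! ### Call counts of the middle loop, the outer loop and the restarts -/

section Complexity

variable {E : Type} [NormedAddCommGroup E] [InnerProductSpace ℝ E]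
  {L Lg : ℝ} {h g : E → ℝ} {h' g' : E → E} {m : InnerMethod}

/-- The behaviour of the remaining repetitions enters as a hypothesis, so that the same step serves
for the special first iteration and for the later contracting ones. -/
theorem SmoothSum.runsTo_gmco_succ [FiniteDimensional ℝ E] (H : SmoothSum L Lg h g h' g')
    (hconv : m = InnerMethod.composite → QuadLower 0 g g') {ζ₀ zs : E}
    (hzs : ∀ v, proxObjective L (fun x => h x + g x) ζ₀ zs ≤
      proxObjective L (fun x => h x + g x) ζ₀ v) (ζ : E) (j a b : ℕ)
    (hnext : ∀ r, MiddleStep L (proxObjective L (fun x => h x + g x) ζ₀)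
        (fun v => h' v + g' v + L • (v - ζ₀)) ζ₀ zs ζ r →
      ¬ ‖h' r + g' r + L • (r - ζ₀)‖ ≤ L / 2 * ‖r - ζ₀‖ →
      RunsTo h' g' (gmco m L Lg L (innerSteps 24 L Lg) ζ₀ j r)
        (fun r => ‖h' r + g' r + L • (r - ζ₀)‖ ≤ L / 2 * ‖r - ζ₀‖) a b) :
    RunsTo h' g' (gmco m L Lg L (innerSteps 24 L Lg) ζ₀ (j + 1) ζ)
      (fun r => ‖h' r + g' r + L • (r - ζ₀)‖ ≤ L / 2 * ‖r - ζ₀‖) (a + 2)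
      (b + (2 * innerSteps 24 L Lg + 1)) := by
  have hL := H.pos
  have hφl := H.quadLower_innerObjective ζ₀ ζ
  have hφu := H.quadUpper_innerObjective ζ₀ ζ
  have hcont : Continuous (innerObjective L h' g ζ₀ ζ) := by
    have := H.continuous_right
    unfold innerObjective
    fun_prop
  obtain ⟨u, hmin⟩ := hφl.exists_forall_le hL hcont
  have hM : 0 < Lg + (L + L) := by linarith [H.le]
  obtain ⟨hN, hexp⟩ := innerSteps_exp_le hL H.le
  have hinner := runsTo_innerAGM (oh := h') (m := m) hL H.le H.upper_right hconv (fun _ => rfl)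
    hφl hφu hmin ζ hN
  refine (RunsTo.gradH_bind (hinner.bind (Q := _) (a' := a + 1) (b' := b + 1)
    fun r hr => ?_)).mono (fun _ hr => hr) (by omega) (by omega)
  refine RunsTo.gradH_bind (RunsTo.gradG_bind ?_)
  have hgrad : ‖g' r + (h' ζ - L • ζ₀ - L • ζ + (L + L) • r)‖ ≤ L / 16 * ‖ζ - u‖ := by
    apply le_of_sq_le_sq _ (by positivity)
    refine (hφu.norm_sq_le hM hmin r).trans ?_
    have h0 := sub_nonneg.2 (hmin r)
    have hLg : 0 < Lg := hL.trans_le H.le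
    calc _ ≤ 2 * (3 * Lg) * (2 * Lg * Real.exp (-(innerSteps 24 L Lg * √(L / Lg) / 2))
            * ‖ζ - u‖ ^ 2) := by
          gcongr
          · linarith [H.le]
          · exact hr
      _ = 12 * Lg ^ 2 * Real.exp (-(innerSteps 24 L Lg * √(L / Lg) / 2)) * ‖ζ - u‖ ^ 2 := by ring
      _ ≤ (L / 16) ^ 2 * ‖ζ - u‖ ^ 2 := by gcongr
      _ = _ := by ring
  split_ifs with htest
  · refine RunsTo.pure ?_ _ _
    exact htest
  · exact hnext r (H.middleStep hzs hmin hgrad) htest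

theorem SmoothSum.runsTo_gmco_of_near [FiniteDimensional ℝ E] (H : SmoothSum L Lg h g h' g')
    (hconv : m = InnerMethod.composite → QuadLower 0 g g') {ζ₀ zs : E}
    (hzs : ∀ v, proxObjective L (fun x => h x + g x) ζ₀ zs ≤
      proxObjective L (fun x => h x + g x) ζ₀ v)
    (hF : ∀ v, proxObjective L (fun x => h x + g x) ζ₀ zs + L / 2 * ‖v - zs‖ ^ 2 ≤
      proxObjective L (fun x => h x + g x) ζ₀ v) (j : ℕ) (ζ : E)
    (hζ : (3 / 4) ^ j * (proxObjective L (fun x => h x + g x) ζ₀ ζ -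
      proxObjective L (fun x => h x + g x) ζ₀ zs) ≤ L * ‖ζ₀ - zs‖ ^ 2 / 200) :
    RunsTo h' g' (gmco m L Lg L (innerSteps 24 L Lg) ζ₀ (j + 1) ζ)
      (fun r => ‖h' r + g' r + L • (r - ζ₀)‖ ≤ L / 2 * ‖r - ζ₀‖) ((j + 1) * 2)
      ((j + 1) * (2 * innerSteps 24 L Lg + 1)) := by
  induction j generalizing ζ with
  | zero =>
    rw [pow_zero, one_mul] at hζ
    exact (H.runsTo_gmco_succ hconv hzs ζ 0 0 0 fun r hr htest =>
      absurd (hr.test H.pos hF hζ) htest).mono (fun _ hr => hr) (by simp) (by simp)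
  | succ j ih =>
    refine (H.runsTo_gmco_succ hconv hzs ζ (j + 1) _ _ fun r hr _ => ih r ?_).mono
      (fun _ hr => hr) (by omega) (by rw [Nat.succ_mul (j + 1)])
    refine le_trans ?_ hζ
    rw [pow_succ, mul_assoc]
    exact mul_le_mul_of_nonneg_left hr.contract (by positivity)

/-- The middle loop stops after at most 23 iterations. -/
theorem SmoothSum.runsTo_gmco [FiniteDimensional ℝ E] (H : SmoothSum L Lg h g h' g')
    (hconv : m = InnerMethod.composite → QuadLower 0 g g') (ζ₀ : E) :
    RunsTo h' g' (gmco m L Lg L (innerSteps 24 L Lg) ζ₀ 23 ζ₀)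
      (fun r => ‖h' r + g' r + L • (r - ζ₀)‖ ≤ L / 2 * ‖r - ζ₀‖) 46
      (23 * (2 * innerSteps 24 L Lg + 1)) := by
  have hL := H.pos
  have hLg : 0 < Lg := hL.trans_le H.le
  have hl := quadLower_proxObjective (L := L) H.convex ζ₀
  rw [zero_add] at hl
  have hu := quadUpper_proxObjective (L := L) (H.upper_left.add H.upper_right) ζ₀
  have hcont : Continuous (proxObjective L (fun x => h x + g x) ζ₀) := by
    have h1 := H.continuous_left
    have h2 := H.continuous_right
    unfold proxObjective
    fun_prop
  obtain ⟨zs, hzs⟩ := hl.exists_forall_le hL hcont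
  have hF := hl.le_of_gradient_eq_zero (hu.gradient_eq_zero (by positivity) hzs)
  -- The count is `23 = 1 + 21 + 1`: the first step gives gap `2 * L * D ^ 2` with `D = ‖ζ₀ - zs‖`,
  -- then 21 contractions reach `L * D ^ 2 / 200` since `(3 / 4) ^ 21 ≤ 1 / 400`, and the last step
  -- passes the test.
  refine (H.runsTo_gmco_succ hconv hzs ζ₀ 22 _ _ fun r hr _ =>
    H.runsTo_gmco_of_near hconv hzs hF 21 r ?_).mono (fun _ hr => hr) (by norm_num) (by omega)
  have h1 := mul_le_mul_of_nonneg_left (hr.first rfl) (show (0 : ℝ) ≤ (3 / 4) ^ 21 by positivity)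
  refine h1.trans ?_
  have h2 : 0 ≤ L * ‖ζ₀ - zs‖ ^ 2 := by positivity
  have h3 : (3 / 4 : ℝ) ^ 21 ≤ 1 / 400 := by norm_num
  nlinarith [mul_le_mul_of_nonneg_right h3 h2]

theorem monteiroSvaiter_coefficient {A a i : ℝ} (hL : 0 < L)
    (hA : i ^ 2 / (4 * L) ≤ A) (ha : a = (1 / L + √(1 / L ^ 2 + 4 * A / L)) / 2) :
    0 < a ∧ L * a ^ 2 = A + a ∧ (i + 1) ^ 2 / (4 * L) ≤ A + a := by
  have hA0 : 0 ≤ A := le_trans (by positivity) hA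
  have hs : √(1 / L ^ 2 + 4 * A / L) ^ 2 = 1 / L ^ 2 + 4 * A / L := Real.sq_sqrt (by positivity)
  refine ⟨by rw [ha]; positivity, ?_, ?_⟩
  · have : L * a ^ 2 = L / 4 * (1 / L ^ 2 + 2 * (1 / L) * √(1 / L ^ 2 + 4 * A / L)
        + √(1 / L ^ 2 + 4 * A / L) ^ 2) := by rw [ha]; ring
    rw [this, hs, ha]
    field_simp
    ring
  · have h1 : i / L ≤ √(1 / L ^ 2 + 4 * A / L) := by
      apply Real.le_sqrt_of_sq_le
      have h2 : (i / L) ^ 2 = 4 * (i ^ 2 / (4 * L)) / L := by field_simp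
      have h3 : 4 * (i ^ 2 / (4 * L)) / L ≤ 4 * A / L := by gcongr
      have h4 : 0 ≤ 1 / L ^ 2 := by positivity
      linarith
    have h2 : (i + 1) ^ 2 / (4 * L) = i ^ 2 / (4 * L) + (1 / L + i / L) / 2 - 1 / (4 * L) := by
      field_simp
      ring
    have h3 : 0 ≤ 1 / (4 * L) := by positivity
    linarith

/-- One iteration of the Monteiro–Svaiter method does not increase the potential. -/
theorem monteiroSvaiter_potential_step {f : E → ℝ} {f' : E → E} (hf : QuadLower 0 f f')
    {A a : ℝ} (hL : 0 < L) (hA : 0 ≤ A) (ha : 0 < a) (haA : L * a ^ 2 = A + a) {x y z y' : E} (u : E)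
    (hx : (A + a) • x = A • y + a • z) (hy' : ‖f' y' + L • (y' - x)‖ ≤ L / 2 * ‖y' - x‖) :
    (A + a) * (f y' - f u) + 1 / 2 * ‖z - a • f' y' - u‖ ^ 2 ≤
      A * (f y - f u) + 1 / 2 * ‖z - u‖ ^ 2 := by
  set D := f' y' with hD
  have h1 := mul_le_mul_of_nonneg_left (hf y' y) hA
  have h2 := mul_le_mul_of_nonneg_left (hf y' u) ha.le
  have h3 : ‖z - a • D - u‖ ^ 2 =
      ‖z - u‖ ^ 2 - 2 * (a * (inner ℝ D z - inner ℝ D u)) + a ^ 2 * ‖D‖ ^ 2 := by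
    rw [sub_right_comm, norm_sub_sq_real, inner_smul_right, real_inner_comm, norm_smul, mul_pow,
      Real.norm_eq_abs, sq_abs, inner_sub_right]
  have h4 : (A + a) * inner ℝ D x = A * inner ℝ D y + a * inner ℝ D z := by
    have : inner ℝ D ((A + a) • x) = inner ℝ D (A • y + a • z) := by rw [hx]
    simpa only [inner_add_right, inner_smul_right] using this
  -- Squaring the stopping test leaves `-3 / 4 * L ^ 2 * ‖y' - x‖ ^ 2` on the right, which is
  -- dropped. Multiplied by `a ^ 2 / 2`, with `L * a ^ 2 = A + a`, the rest pays for the gradient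
  -- step in `z`.
  have h5 : 2 * L * inner ℝ D (y' - x) + ‖D‖ ^ 2 ≤ 0 := by
    have h6 := pow_le_pow_left₀ (norm_nonneg _) hy' 2
    rw [norm_add_sq_real, inner_smul_right, norm_smul, Real.norm_of_nonneg hL.le] at h6
    nlinarith [sq_nonneg (L * ‖y' - x‖)]
  have h7 : (A + a) * inner ℝ D (y' - x) + a ^ 2 / 2 * ‖D‖ ^ 2 ≤ 0 := by
    have := mul_le_mul_of_nonneg_left h5 (show 0 ≤ a ^ 2 / 2 by positivity)
    rw [← haA]
    linarith
  rw [h3]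
  simp only [inner_sub_right, ← hD] at *
  linarith

theorem SmoothSum.runsTo_msLoop [FiniteDimensional ℝ E] (H : SmoothSum L Lg h g h' g')
    (hconv : m = InnerMethod.composite → QuadLower 0 g g') (u : E) (k i : ℕ) (A : ℝ) (y z : E)
    (hA : (i : ℝ) ^ 2 / (4 * L) ≤ A) :
    RunsTo h' g' (msLoop m L Lg L (innerSteps 24 L Lg) 23 k A y z)
      (fun r => ∃ A', ((i + k : ℕ) : ℝ) ^ 2 / (4 * L) ≤ A' ∧
        A' * (h r + g r - (h u + g u)) ≤ A * (h y + g y - (h u + g u)) + 1 / 2 * ‖z - u‖ ^ 2)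
      (k * 47) (k * (23 * (2 * innerSteps 24 L Lg + 1) + 1)) := by
  induction k generalizing i A y z with
  | zero =>
    refine RunsTo.pure ⟨A, hA, ?_⟩ _ _
    have : 0 ≤ 1 / 2 * ‖z - u‖ ^ 2 := by positivity
    linarith
  | succ k ih =>
    have hL := H.pos
    have hA0 : 0 ≤ A := le_trans (by positivity) hA
    set a := (1 / L + √(1 / L ^ 2 + 4 * A / L)) / 2 with ha
    obtain ⟨ha0, haA, hgrow⟩ := monteiroSvaiter_coefficient hL hA ha
    have hAa : 0 < A + a := by positivity
    refine ((H.runsTo_gmco hconv ((A / (A + a)) • y + (a / (A + a)) • z)).bind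
      (a' := k * 47 + 1) (b' := k * (23 * (2 * innerSteps 24 L Lg + 1) + 1) + 1)
      fun y' hy' => RunsTo.gradH_bind (RunsTo.gradG_bind ?_)).mono (fun _ hr => hr) (by omega)
      (Eq.le (by ring))
    have hstep := monteiroSvaiter_potential_step H.convex hL hA0 ha0 haA (y := y) (z := z) u
      (by rw [smul_add, smul_smul, smul_smul, mul_div_cancel₀ _ hAa.ne', mul_div_cancel₀ _ hAa.ne'])
      hy'
    refine (ih (i + 1) (A + a) y' _ (by exact_mod_cast hgrow)).mono ?_ le_rfl le_rfl
    rintro r ⟨A', h1, h2⟩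
    exact ⟨A', by rwa [show i + (k + 1) = i + 1 + k by ring], h2.trans hstep⟩

theorem SmoothSum.runsTo_ms [FiniteDimensional ℝ E] (H : SmoothSum L Lg h g h' g')
    (hconv : m = InnerMethod.composite → QuadLower 0 g g') {u : E}
    (hu : ∀ x, h u + g u ≤ h x + g x) (k : ℕ) (x₀ : E) :
    RunsTo h' g' (ms m L Lg L (innerSteps 24 L Lg) 23 k x₀)
      (fun r => k ^ 2 * (h r + g r - (h u + g u)) ≤ 2 * L * ‖x₀ - u‖ ^ 2)
      (k * 47) (k * (23 * (2 * innerSteps 24 L Lg + 1) + 1)) := by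
  have hL := H.pos
  refine (H.runsTo_msLoop hconv u k 0 0 x₀ x₀ (by simp)).mono ?_ le_rfl le_rfl
  rintro r ⟨A', h1, h2⟩
  rw [zero_add] at h1
  have h3 := (mul_le_mul_of_nonneg_right h1 (sub_nonneg.2 (hu r))).trans h2
  calc _ = 4 * L * ((k : ℝ) ^ 2 / (4 * L) * (h r + g r - (h u + g u))) := by field_simp
    _ ≤ 4 * L * (0 * (h x₀ + g x₀ - (h u + g u)) + 1 / 2 * ‖x₀ - u‖ ^ 2) := by gcongr
    _ = _ := by ring

/-- The alternative in `hT` is needed because only the distance from the starting point is bounded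
at the outset; a bound on the function value holds after the first run. -/
theorem SmoothSum.runsTo_msRestart [FiniteDimensional ℝ E] (H : SmoothSum L Lg h g h' g')
    (hconv : m = InnerMethod.composite → QuadLower 0 g g') {μ : ℝ} (hμ : 0 < μ)
    (hlow : QuadLower μ (fun x => h x + g x) (fun x => h' x + g' x)) {u : E}
    (hu : ∀ x, h u + g u ≤ h x + g x) {k : ℕ} (hk : 8 * L / μ ≤ k ^ 2) (T : ℕ) (x : E) {B : ℝ}
    (hx : ‖x - u‖ ^ 2 ≤ B) (hT : 1 ≤ T ∨ h x + g x - (h u + g u) ≤ μ / 2 * B) :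
    RunsTo h' g' (msRestart m L Lg L (innerSteps 24 L Lg) 23 k T x)
      (fun r => 2 ^ T * (h r + g r - (h u + g u)) ≤ μ / 2 * B)
      (T * (k * 47)) (T * (k * (23 * (2 * innerSteps 24 L Lg + 1) + 1))) := by
  have hL := H.pos
  have hLg : 0 < Lg := hL.trans_le H.le
  have hk0 : 0 < (k : ℝ) ^ 2 := lt_of_lt_of_le (by positivity) hk
  induction T generalizing x B with
  | zero => exact RunsTo.pure (by simpa using hT) _ _
  | succ T ih =>
    refine ((H.runsTo_ms hconv hu k x).bind (a' := T * (k * 47))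
      (b' := T * (k * (23 * (2 * innerSteps 24 L Lg + 1) + 1))) fun y hy => ?_).mono
      (fun _ hr => hr) (Eq.le (by ring)) (Eq.le (by ring))
    -- One run gives gap at most `2 * L * B / k ^ 2`, and `k ^ 2 ≥ 8 * L / μ` makes this `μ * B /
    -- 4`; strong convexity then halves `B`.
    have h1 : h y + g y - (h u + g u) ≤ μ / 2 * (B / 2) := by
      have h2 := (mul_le_mul_of_nonneg_right hk (sub_nonneg.2 (hu y))).trans hy
      have h3 : 8 * L / μ * (h y + g y - (h u + g u)) ≤ 8 * L / μ * (μ / 2 * (B / 2)) := by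
        have h4 : 8 * L / μ * (μ / 2 * (B / 2)) = 2 * L * B := by field_simp; ring
        rw [h4]
        exact h2.trans (by gcongr)
      exact le_of_mul_le_mul_left h3 (by positivity)
    have h5 := hlow.le_of_gradient_eq_zero
      ((H.upper_left.add H.upper_right).gradient_eq_zero (by positivity) hu) y
    have h6 : ‖y - u‖ ^ 2 ≤ B / 2 :=
      le_of_mul_le_mul_left (a := μ / 2) (by linarith) (by positivity)
    refine (ih y h6 (Or.inr h1)).mono (fun r hr => ?_) le_rfl le_rfl
    rw [pow_succ]
    linarith

end Complexity

/-! ### Numerical bounds for the iteration counts -/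

section IterationCounts

theorem convexIters_le {L R ε : ℝ} (hε : 0 < ε) (h : ε ≤ L * R ^ 2) :
    (convexIters L R ε : ℝ) ≤ 3 * √(L * R ^ 2 / ε) := by
  have h1 : 1 ≤ √(L * R ^ 2 / ε) := Real.one_le_sqrt.2 ((one_le_div hε).2 h)
  have h2 : √(2 * L * R ^ 2 / ε) ≤ 2 * √(L * R ^ 2 / ε) := by
    rw [show 2 * L * R ^ 2 / ε = 2 * (L * R ^ 2 / ε) by ring, Real.sqrt_mul (by norm_num)]
    gcongr
    exact Real.sqrt_le_iff.2 ⟨by norm_num, by norm_num⟩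
  have h3 := Nat.ceil_lt_add_one (Real.sqrt_nonneg (2 * L * R ^ 2 / ε))
  unfold convexIters
  linarith

theorem le_convexIters_sq {L R ε : ℝ} (hL : 0 ≤ L) (hε : 0 < ε) :
    2 * L * R ^ 2 ≤ ε * (convexIters L R ε : ℝ) ^ 2 := by
  have h1 : √(2 * L * R ^ 2 / ε) ≤ convexIters L R ε := Nat.le_ceil _
  have h2 := pow_le_pow_left₀ (Real.sqrt_nonneg _) h1 2
  rw [Real.sq_sqrt (by positivity), div_le_iff₀ hε] at h2
  linarith

theorem restartIters_le {L μ : ℝ} (hμ : 0 < μ) (h : μ ≤ L) :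
    (restartIters L μ : ℝ) ≤ 4 * √(L / μ) := by
  have h1 : 1 ≤ √(L / μ) := Real.one_le_sqrt.2 ((one_le_div hμ).2 h)
  have h2 : √(8 * L / μ) ≤ 3 * √(L / μ) := by
    rw [mul_div_assoc, Real.sqrt_mul (by norm_num)]
    gcongr
    exact Real.sqrt_le_iff.2 ⟨by norm_num, by norm_num⟩
  have h3 := Nat.ceil_lt_add_one (Real.sqrt_nonneg (8 * L / μ))
  unfold restartIters
  linarith

theorem le_restartIters_sq {L μ : ℝ} (hL : 0 ≤ L) (hμ : 0 < μ) :
    8 * L / μ ≤ (restartIters L μ : ℝ) ^ 2 := by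
  have h1 : √(8 * L / μ) ≤ restartIters L μ := Nat.le_ceil _
  have h2 := pow_le_pow_left₀ (Real.sqrt_nonneg _) h1 2
  rwa [Real.sq_sqrt (by positivity)] at h2

theorem restartCount_le (μ R ε : ℝ) :
    (restartCount μ R ε : ℝ) ≤ 2 * (1 + Real.posLog (μ * R ^ 2 / ε)) := by
  set X := μ * R ^ 2 / ε with hX
  have hp : 0 ≤ Real.posLog X := Real.posLog_nonneg
  have hlog : Real.logb 2 X ≤ 2 * Real.posLog X := by
    rw [Real.logb, div_le_iff₀ (Real.log_pos one_lt_two)]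
    have h1 : Real.log X ≤ Real.posLog X := le_max_right _ _
    nlinarith [Real.log_two_gt_d9]
  have h2 : (⌈Real.logb 2 X⌉₊ : ℝ) ≤ 2 * Real.posLog X + 1 :=
    (Nat.cast_le.2 (Nat.ceil_le_ceil hlog)).trans (Nat.ceil_lt_add_one (by positivity)).le
  rw [restartCount, Nat.cast_max, Nat.cast_one]
  exact max_le (by linarith) (by linarith)

theorem le_two_pow_restartCount {μ R ε : ℝ} (hμ : 0 ≤ μ) (hε : 0 < ε) :
    μ * R ^ 2 ≤ ε * 2 ^ restartCount μ R ε := by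
  rw [← div_le_iff₀' hε]
  -- The argument of the logarithm vanishes when `R = 0`, so this case is separate.
  rcases (show 0 ≤ μ * R ^ 2 / ε by positivity).eq_or_lt with h | h
  · rw [← h]; positivity
  · rw [← Real.rpow_natCast 2, ← Real.logb_le_iff_le_rpow one_lt_two h]
    refine (Nat.le_ceil _).trans ?_
    exact_mod_cast le_max_right _ _

theorem innerSteps_le {L Lg : ℝ} (hL : 0 < L) (hLg : L ≤ Lg) :
    (innerSteps 24 L Lg : ℝ) ≤ 25 * (√(Lg / L) * (1 + Real.log (Lg / L))) := by
  have h0 : 1 ≤ Lg / L := (one_le_div hL).2 hLg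
  have h1 : 1 ≤ √(Lg / L) := Real.one_le_sqrt.2 h0
  have h2 := Real.log_nonneg h0
  have h3 : (innerSteps 24 L Lg : ℝ) < 24 * √(Lg / L) * (1 + Real.log (Lg / L)) + 1 :=
    Nat.ceil_lt_add_one (by positivity)
  nlinarith

/-- The number of `g`-calls per iteration of the main loop. -/
theorem callsPerIteration_le {L Lg : ℝ} (hL : 0 < L) (hLg : L ≤ Lg) :
    ((23 * (2 * innerSteps 24 L Lg + 1) + 1 : ℕ) : ℝ) ≤
      1750 * (√(Lg / L) * (1 + Real.log (Lg / L))) := by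
  have h1 : (1 : ℝ) ≤ innerSteps 24 L Lg := by exact_mod_cast (innerSteps_exp_le hL hLg).1
  have h2 := innerSteps_le hL hLg
  push_cast
  linarith

end IterationCounts

/-! ### Assembly of the complexity bounds -/

theorem IsLSmooth.smoothSum {E : Type} [NormedAddCommGroup E] [InnerProductSpace ℝ E]
    [CompleteSpace E] {L Lg μ : ℝ} {h g : E → ℝ} (hL : 0 < L) (hLg : L ≤ Lg) (hh : IsLSmooth L h)
    (hg : IsLSmooth Lg g) (hμ : 0 ≤ μ)
    (hf : QuadLower μ (fun x => h x + g x) (fun x => gradient h x + gradient g x)) :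
    SmoothSum L Lg h g (gradient h) (gradient g) where
  pos := hL
  le := hLg
  lipschitz := hh.2
  lower_left := hh.quadLower
  upper_left := hh.quadUpper
  upper_right := hg.quadUpper
  convex := fun x y => by
    have h1 := hf x y
    have h2 : 0 ≤ μ / 2 * ‖y - x‖ ^ 2 := by positivity
    linarith
  continuous_left := hh.1.continuous
  continuous_right := hg.1.continuous

theorem corollary1 :
    ∃ (c C : ℝ) (K : ℕ), 0 < c ∧ 0 < C ∧
      ∀ (m : InnerMethod) (n : ℕ) (h g : EuclideanSpace ℝ (Fin n) → ℝ) (Lh Lg μ R ε : ℝ)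
        (x₀ xstar : EuclideanSpace ℝ (Fin n)),
        0 < Lh → Lh ≤ Lg → IsLSmooth Lh h → IsLSmooth Lg g →
        0 ≤ μ → StrongConvexOn Set.univ μ (fun x => h x + g x) →
        (m = InnerMethod.composite → ConvexOn ℝ Set.univ g) →
        (∀ x, h xstar + g xstar ≤ h x + g x) → ‖x₀ - xstar‖ ≤ R → 0 < ε →
        (μ = 0 → ε ≤ Lh * R ^ 2 →
          ∃ r, (ms m Lh Lg Lh (innerSteps c Lh Lg) K (convexIters Lh R ε) x₀).run
                (gradient h) (gradient g) = some r ∧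
            (h r.output + g r.output) - (h xstar + g xstar) ≤ ε ∧
            (r.hCalls : ℝ) ≤ C * √(Lh * R ^ 2 / ε) ∧
            (r.gCalls : ℝ) ≤ C * √(Lg * R ^ 2 / ε) * (1 + Real.log (Lg / Lh))) ∧
        (0 < μ → μ ≤ Lh →
          ∃ r, (msRestart m Lh Lg Lh (innerSteps c Lh Lg) K (restartIters Lh μ)
                (restartCount μ R ε) x₀).run (gradient h) (gradient g) = some r ∧
            (h r.output + g r.output) - (h xstar + g xstar) ≤ ε ∧
            (r.hCalls : ℝ) ≤ C * √(Lh / μ) * (1 + Real.posLog (μ * R ^ 2 / ε)) ∧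
            (r.gCalls : ℝ) ≤ C * √(Lg / μ) * (1 + Real.posLog (μ * R ^ 2 / ε)) *
              (1 + Real.log (Lg / Lh))) := by
  -- `14000 = 2 * 4 * 1750` is the largest factor needed, namely for the calls for `g` with
  -- restarts: number of runs, iterations per run, calls per iteration.
  refine ⟨24, 14000, 23, by norm_num, by norm_num, ?_⟩
  intro m n h g Lh Lg μ R ε x₀ xstar hL hLg hh hg hμ hsc hconv hmin hR hε
  have hLg0 : 0 < Lg := hL.trans_le hLg
  have hlow : QuadLower μ (fun x => h x + g x) (fun x => gradient h x + gradient g x) := by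
    have := hsc.quadLower (hh.1.fun_add hg.1)
    rwa [show gradient (fun x => h x + g x) = fun x => gradient h x + gradient g x from
      funext (gradient_fun_add hh.1 hg.1)] at this
  have H := IsLSmooth.smoothSum hL hLg hh hg hμ hlow
  have hconv' : m = InnerMethod.composite → QuadLower 0 g (gradient g) := fun hm =>
    (strongConvexOn_zero.2 (hconv hm)).quadLower hg.1
  have hR2 : ‖x₀ - xstar‖ ^ 2 ≤ R ^ 2 := pow_le_pow_left₀ (norm_nonneg _) hR 2
  have hl : 0 ≤ Real.log (Lg / Lh) := Real.log_nonneg ((one_le_div hL).2 hLg)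
  have hcalls := callsPerIteration_le hL hLg
  refine ⟨fun _ hεR => ?_, fun hμ0 hμL => ?_⟩
  · obtain ⟨r, hrun, hval, hhc, hgc⟩ := H.runsTo_ms hconv' hmin (convexIters Lh R ε) x₀
    have hk := convexIters_le hε hεR
    have hk2 := le_convexIters_sq (R := R) hL.le hε
    have hR0 : 0 < R ^ 2 := pos_of_mul_pos_right (hε.trans_le hεR) hL.le
    refine ⟨r, hrun, ?_, ?_, ?_⟩
    · have h1 : (0 : ℝ) < (convexIters Lh R ε : ℝ) ^ 2 :=
        pos_of_mul_pos_right (lt_of_lt_of_le (by positivity) hk2) hε.le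
      refine le_of_mul_le_mul_left (hval.trans ?_) h1
      rw [mul_comm _ ε]
      exact le_trans (by gcongr) hk2
    · have h1 : (r.hCalls : ℝ) ≤ convexIters Lh R ε * 47 := by exact_mod_cast hhc
      have h2 : 0 ≤ √(Lh * R ^ 2 / ε) := Real.sqrt_nonneg _
      linarith
    · have h1 : (r.gCalls : ℝ) ≤ convexIters Lh R ε *
          ((23 * (2 * innerSteps 24 Lh Lg + 1) + 1 : ℕ) : ℝ) := by exact_mod_cast hgc
      have h2 : √(Lg * R ^ 2 / ε) = √(Lh * R ^ 2 / ε) * √(Lg / Lh) := by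
        rw [← Real.sqrt_mul (by positivity)]
        congr 1
        field_simp
      calc (r.gCalls : ℝ) ≤ _ := h1
        _ ≤ 3 * √(Lh * R ^ 2 / ε) * (1750 * (√(Lg / Lh) * (1 + Real.log (Lg / Lh)))) := by gcongr
        _ = 5250 * (√(Lh * R ^ 2 / ε) * √(Lg / Lh)) * (1 + Real.log (Lg / Lh)) := by ring
        _ ≤ _ := by rw [h2]; gcongr; norm_num
  · have hk := restartIters_le hμ0 hμL
    have hT := restartCount_le μ R ε
    have hT2 := le_two_pow_restartCount (R := R) hμ hε
    have hp : 0 ≤ Real.posLog (μ * R ^ 2 / ε) := Real.posLog_nonneg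
    obtain ⟨r, hrun, hval, hhc, hgc⟩ := H.runsTo_msRestart hconv' hμ0 hlow hmin
      (le_restartIters_sq hL.le hμ0) (restartCount μ R ε) x₀ hR2 (Or.inl (le_max_left _ _))
    refine ⟨r, hrun, ?_, ?_, ?_⟩
    · refine le_of_mul_le_mul_left (hval.trans ?_)
        (show (0 : ℝ) < 2 ^ restartCount μ R ε by positivity)
      have : 0 ≤ μ * R ^ 2 := by positivity
      linarith
    · have h1 : (r.hCalls : ℝ) ≤ restartCount μ R ε * (restartIters Lh μ * 47) := by
        exact_mod_cast hhc
      calc (r.hCalls : ℝ) ≤ _ := h1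
        _ ≤ 2 * (1 + Real.posLog (μ * R ^ 2 / ε)) * (4 * √(Lh / μ) * 47) := by gcongr
        _ = 376 * √(Lh / μ) * (1 + Real.posLog (μ * R ^ 2 / ε)) := by ring
        _ ≤ _ := by gcongr; norm_num
    · have h1 : (r.gCalls : ℝ) ≤ restartCount μ R ε * (restartIters Lh μ *
          ((23 * (2 * innerSteps 24 Lh Lg + 1) + 1 : ℕ) : ℝ)) := by exact_mod_cast hgc
      have h2 : √(Lg / μ) = √(Lh / μ) * √(Lg / Lh) := by
        rw [← Real.sqrt_mul (by positivity)]
        congr 1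
        field_simp
      calc (r.gCalls : ℝ) ≤ _ := h1
        _ ≤ 2 * (1 + Real.posLog (μ * R ^ 2 / ε)) * (4 * √(Lh / μ) *
            (1750 * (√(Lg / Lh) * (1 + Real.log (Lg / Lh))))) := by gcongr
        _ = _ := by rw [h2]; ring
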